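/- Let $\mathcal C$ be a triangulated category, $\Lambda$ a free abelian group of finite rank, $v\colon K(\mathcal C)\to\Lambda$ a surjective homomorphism, and fix an inner product on $\Lambda\otimes\mathbb R$ with norm $\|\cdot\|$. Write $Z(c)=Z(v([c]))$ for $Z\in\mathrm{Hom}(\Lambda,\mathbb C)$ and $c\in\mathcal C$. A slicing $P$ consists of strictly full additive subcategories $P(\phi)\subset\mathcal C$ ($\phi\in\mathbb R$) with $P(\phi+1)=P(\phi)[1]$, with $\mathrm{Hom}(c,c')=0$ for $c\in P(\phi)$, $c'\in P(\phi')$, $\phi>\phi'$, and such that every object has a finite Harder–Narasimhan filtration with nonzero semistable factors in slices of strictly decreasing phase; $P(I)$ is the full subcategory of objects whose semistable factors have phase in $I$. $P$ is locally finite if there is $0<\epsilon<1/2$ such that, for every $\phi$, each object of $P(\phi-\epsilon,\phi+\epsilon)$ satisfies the ascending and descending chain conditions on strict subobjects. A stable object is an object of some $P(\phi)$ that is nonzero and has no proper nonzero strict subobject in $P(\phi)$. A lax pre-stability condition is a pair $\sigma=(P,Z)$ of a locally finite slicing $P$ and $Z\in\mathrm{Hom}(\Lambda,\mathbb C)$ such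 that $0\ne c\in P(\phi)$ implies $Z(c)=m(c)e^{i\pi\phi}$ with $m(c)\in\mathbb R_{\ge0}$; it is a pre-stability condition if always $m(c)>0$. The mass $m(c)$ of any object $c$ is the sum of the masses of its semistable factors; $c$ is massless if $m(c)=0$ and massive if $m(c)>0$. A lax stability condition is a lax pre-stability condition for which there is $K>0$ with $|Z(s)|\ge\|v(s)\|/K$ for all massive stable $s$. A stability condition is a pre-stability condition for which there is $K>0$ with $|Z(c)|\ge\|v(c)\|/K$ for all semistable $c$. Let $\sigma=(P,Z)$ be a lax pre-stability condition and $\mathcal N$ its massless subcategory, the full subcategory of massless objects. Let $\Lambda_{\mathcal N}\subset\Lambda$ be the smallest primitive sublattice containing $v([c])$ for all $c\in\mathcal N$. Then $\mathcal N$ is a thick triangulated subcategory, $\Lambda/\Lambda_{\mathcal N}$ is free of finite rank, $v$ induces a surjective homomorphism $v_{\mathcal C/\mathcal N}\colon K(\mathcal C/\mathcal N)\to\Lambda/\Lambda_{\mathcal N}$ on the Grothendieck group of the Verdier quotient, and $Z$ factors through $\Lambda/\Lambda_{\mathcal N}$. Let $P_{\mathcal C/\mathcal N}(\phi)$ be the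 isomorphism closure of $P(\phi)$ in $\mathcal C/\mathcal N$ and put $\mu_{\mathcal N}(\sigma)=(P_{\mathcal C/\mathcal N},Z)$. 1. Suppose that $P$ is well-adapted to $\mathcal N$, i.e. the semistable factors of objects of $\mathcal N$ lie in $\mathcal N$, $P(I)\cap\mathcal N$ is a Serre subcategory of the abelian category $P(I)$ for every $I=(\phi,\phi+1]$ and $I=[\phi,\phi+1)$, and $P_{\mathcal C/\mathcal N}$ is locally finite. Then $\mu_{\mathcal N}(\sigma)$ is a pre-stability condition on $\mathcal C/\mathcal N$ with respect to $v_{\mathcal C/\mathcal N}$. 2. If $\sigma$ is a lax stability condition, then $\mu_{\mathcal N}(\sigma)$ is a stability condition on $\mathcal C/\mathcal N$ with respect to $v_{\mathcal C/\mathcal N}$ and the quotient norm $\|\lambda+\Lambda_{\mathcal N}\otimes\mathbb R\|=\inf\{\|\lambda+\alpha\|:\alpha\in\Lambda_{\mathcal N}\otimes\mathbb R\}$ on $(\Lambda/\Lambda_{\mathcal N})\otimes\mathbb R$. -/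

import Mathlib

open CategoryTheory CategoryTheory.Limits CategoryTheory.Pretriangulated
open scoped TensorProduct

universe w v u

namespace LaxStability

/-! ### Length categories and simple objects -/

section Length

variable {A : Type u} [Category.{v} A] [HasZeroMorphisms A]

/-- A strict monomorphism. In a category with kernels and cokernels, a monomorphism is strict
(its canonical map from coimage to image is invertible) iff it is the kernel of some morphism. -/
def IsStrictMono {X Y : A} (f : X ⟶ Y) : Prop := Nonempty (NormalMono f)

/-- The partially ordered type of strict subobjects of `X`. -/
abbrev StrictSubobject (X : A) := {S : Subobject X // IsStrictMono S.arrow}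

variable (A) in
/-- `A` is artinian and noetherian: descending and ascending chains of strict subobjects of an
object stabilise. -/
def IsLengthCategory : Prop :=
  ∀ X : A, WellFoundedLT (StrictSubobject X) ∧ WellFoundedGT (StrictSubobject X)

/-- `X` is nonzero and has no proper nonzero strict subobjects. -/
def IsStrictSimple (X : A) : Prop :=
  ¬ IsZero X ∧ ∀ (Y : A) (f : Y ⟶ X), IsStrictMono f → IsZero Y ∨ IsIso f

end Length

/-! ### Slicings -/

section Slicing

variable {C : Type u} [Category.{v} C] [Preadditive C] [HasZeroObject C] [HasShift C ℤ]
  [∀ n : ℤ, (shiftFunctor C n).Additive] [Pretriangulated C]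

/-- A Harder–Narasimhan filtration `0 = c₀ ⟶ c₁ ⟶ ⋯ ⟶ cₙ ≅ X` with respect to the family of
subcategories `P`. The factor `aᵢ = factor i` (for `i < n`) is a cone of `cᵢ ⟶ cᵢ₊₁`, it is
nonzero and lies in `P (phase i)`, and the phases decrease strictly. The values of `obj` at
`i > n` and of `factor`, `phase` at `i ≥ n` play no role. -/
structure HNFiltration (P : ℝ → ObjectProperty C) (X : C) where
  n : ℕ
  obj : ℕ → C
  factor : ℕ → C
  phase : ℕ → ℝ
  isZero_obj_zero : IsZero (obj 0)
  topIso : obj n ≅ X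
  triangle : ∀ i < n, ∃ (f : obj i ⟶ obj (i + 1)) (g : obj (i + 1) ⟶ factor i)
    (h : factor i ⟶ (obj i)⟦(1 : ℤ)⟧), Triangle.mk f g h ∈ distTriang C
  semistable : ∀ i < n, P (phase i) (factor i)
  factor_ne_zero : ∀ i < n, ¬ IsZero (factor i)
  phase_lt : ∀ i j, i < j → j < n → phase j < phase i

/-- A slicing: (strictly) full additive subcategories `P φ` with `P (φ + 1) = P φ [1]`, no nonzero
morphisms from higher to lower phase, and Harder–Narasimhan filtrations. -/
structure IsSlicing (P : ℝ → ObjectProperty C) : Prop where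
  isoClosed : ∀ φ, (P φ).IsClosedUnderIsomorphisms
  containsZero : ∀ φ, (P φ).ContainsZero
  biprod_mem : ∀ φ (X Y : C), P φ X → P φ Y → P φ (X ⊞ Y)
  shift_iff : ∀ φ (X : C), P (φ + 1) (X⟦(1 : ℤ)⟧) ↔ P φ X
  hom_eq_zero : ∀ φ ψ (X Y : C), ψ < φ → P φ X → P ψ Y → ∀ f : X ⟶ Y, f = 0
  exists_hn : ∀ X : C, Nonempty (HNFiltration P X)

/-- The subcategory `P(I)` of objects all of whose semistable factors have phase in `I`. -/
def interval (P : ℝ → ObjectProperty C) (I : Set ℝ) : ObjectProperty C :=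
  fun X => ∃ h : HNFiltration P X, ∀ i < h.n, h.phase i ∈ I

/-- Local finiteness: for some `ε > 0` all categories `P(φ - ε, φ + ε)` are of finite length.
The intervals are required to have length `2 ε < 1`, for which `P(φ - ε, φ + ε)` is quasi-abelian
when `P` is a slicing. -/
def IsLocallyFinite (P : ℝ → ObjectProperty C) : Prop :=
  ∃ ε : ℝ, 0 < ε ∧ ε < 1 / 2 ∧
    ∀ φ : ℝ, IsLengthCategory (interval P (Set.Ioo (φ - ε) (φ + ε))).FullSubcategory

/-- `X` is stable of phase `φ`: a simple object of the quasi-abelian category `P φ`. -/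
def IsStable (P : ℝ → ObjectProperty C) (φ : ℝ) (X : C) : Prop :=
  ∃ h : P φ X, IsStrictSimple (⟨X, h⟩ : (P φ).FullSubcategory)

end Slicing

/-! ### Grothendieck groups -/

section K0

variable (C : Type u) [Category.{v} C] [Preadditive C] [HasZeroObject C] [HasShift C ℤ]
  [∀ n : ℤ, (shiftFunctor C n).Additive] [Pretriangulated C]

/-- The Grothendieck group: the free abelian group on the objects modulo the relations
`[Y] = [X] + [Z]` for all distinguished triangles `X ⟶ Y ⟶ Z ⟶ X⟦1⟧`. -/
abbrev K0 : Type u :=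
  FreeAbelianGroup C ⧸ AddSubgroup.closure
    {x : FreeAbelianGroup C | ∃ T ∈ distTriang C, x = FreeAbelianGroup.of T.obj₂ -
      (FreeAbelianGroup.of T.obj₁ + FreeAbelianGroup.of T.obj₃)}

variable {C} in
/-- The class of an object in the Grothendieck group. -/
def K0.of (X : C) : K0 C := QuotientAddGroup.mk (FreeAbelianGroup.of X)

end K0

/-! ### Stability conditions and lax stability conditions -/

section Stability

variable {C : Type u} [Category.{v} C] [Preadditive C] [HasZeroObject C] [HasShift C ℤ]
  [∀ n : ℤ, (shiftFunctor C n).Additive] [Pretriangulated C]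
  {Λ : Type w} [AddCommGroup Λ]

/-- A pre-stability condition `(P, Z)`: the slicing `P` is locally finite, and the charge of a
nonzero semistable object of phase `φ` lies on the open ray of argument `π φ`. -/
structure IsPreStabilityCondition (cl : K0 C →+ Λ) (P : ℝ → ObjectProperty C) (Z : Λ →+ ℂ) :
    Prop where
  isSlicing : IsSlicing P
  isLocallyFinite : IsLocallyFinite P
  charge : ∀ (φ : ℝ) (X : C), P φ X → ¬ IsZero X →
    ∃ m : ℝ, 0 < m ∧ Z (cl (K0.of X)) = m * Complex.exp (Complex.I * Real.pi * φ)

/-- A lax pre-stability condition: as a pre-stability condition, but semistable objects may have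
mass zero. -/
structure IsLaxPreStabilityCondition (cl : K0 C →+ Λ) (P : ℝ → ObjectProperty C) (Z : Λ →+ ℂ) :
    Prop where
  isSlicing : IsSlicing P
  isLocallyFinite : IsLocallyFinite P
  charge : ∀ (φ : ℝ) (X : C), P φ X → ¬ IsZero X →
    ∃ m : ℝ, 0 ≤ m ∧ Z (cl (K0.of X)) = m * Complex.exp (Complex.I * Real.pi * φ)

open Classical in
/-- The mass of an object: the sum of the masses `‖Z a‖` of its semistable factors `a`
(Harder–Narasimhan filtrations with respect to a slicing exist, and their factors are unique up to
isomorphism). -/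
noncomputable def mass (cl : K0 C →+ Λ) (P : ℝ → ObjectProperty C) (Z : Λ →+ ℂ) (X : C) : ℝ :=
  if h : Nonempty (HNFiltration P X) then
    ∑ i ∈ Finset.range h.some.n, ‖Z (cl (K0.of (h.some.factor i)))‖
  else 0

/-- The massless subcategory: the full subcategory on the objects of mass zero. -/
def massless (cl : K0 C →+ Λ) (P : ℝ → ObjectProperty C) (Z : Λ →+ ℂ) : ObjectProperty C :=
  fun X => mass cl P Z X = 0

/-- A stability condition: a pre-stability condition with the support property, with respect to
the function `nrm : Λ → ℝ` (the restriction of a norm on `Λ ⊗ ℝ`). -/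
structure IsStabilityCondition (nrm : Λ → ℝ) (cl : K0 C →+ Λ) (P : ℝ → ObjectProperty C)
    (Z : Λ →+ ℂ) : Prop extends IsPreStabilityCondition cl P Z where
  support : ∃ K : ℝ, 0 < K ∧ ∀ (φ : ℝ) (X : C), P φ X →
    1 / K * nrm (cl (K0.of X)) ≤ ‖Z (cl (K0.of X))‖

/-- A lax stability condition: a lax pre-stability condition with the support property for massive
stable objects. -/
structure IsLaxStabilityCondition (nrm : Λ → ℝ) (cl : K0 C →+ Λ) (P : ℝ → ObjectProperty C)
    (Z : Λ →+ ℂ) : Prop extends IsLaxPreStabilityCondition cl P Z where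
  support : ∃ K : ℝ, 0 < K ∧ ∀ (φ : ℝ) (X : C), IsStable P φ X → 0 < mass cl P Z X →
    1 / K * nrm (cl (K0.of X)) ≤ ‖Z (cl (K0.of X))‖

end Stability

/-! ### Lattices and norms -/

section Lattice

variable {Λ : Type w} [AddCommGroup Λ]

/-- The restriction to `Λ` of the norm of an inner product on `ℝ ⊗ Λ`. -/
noncomputable def latticeNorm (ip : InnerProductSpace.Core ℝ (ℝ ⊗[ℤ] Λ)) (l : Λ) : ℝ :=
  √(ip.inner ((1 : ℝ) ⊗ₜ[ℤ] l) ((1 : ℝ) ⊗ₜ[ℤ] l))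

/-- The restriction to `Λ ⧸ M` of the quotient norm on `(ℝ ⊗ Λ) ⧸ (ℝ ⊗ M)`:
`‖l + ℝ ⊗ M‖ = inf {‖l + a‖ : a ∈ ℝ ⊗ M}`. -/
noncomputable def quotientNorm (ip : InnerProductSpace.Core ℝ (ℝ ⊗[ℤ] Λ)) (M : AddSubgroup Λ)
    (q : Λ ⧸ M) : ℝ :=
  sInf {r : ℝ | ∃ l : Λ, (QuotientAddGroup.mk l : Λ ⧸ M) = q ∧
    ∃ a ∈ Submodule.span ℝ {x : ℝ ⊗[ℤ] Λ | ∃ m ∈ M, x = (1 : ℝ) ⊗ₜ[ℤ] m},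
      r = √(ip.inner ((1 : ℝ) ⊗ₜ[ℤ] l + a) ((1 : ℝ) ⊗ₜ[ℤ] l + a))}

end Lattice

/-! ### Thick subcategories and Verdier quotients -/

section Quotient

variable {C : Type u} [Category.{v} C] [Preadditive C] [HasZeroObject C] [HasShift C ℤ]
  [∀ n : ℤ, (shiftFunctor C n).Additive] [Pretriangulated C]

/-- The Verdier quotient `C/N`: the localization of `C` at the morphisms with cone in `N`. -/
abbrev VerdierQuotient (N : ObjectProperty C) := N.trW.Localization

/-- The slices `P_{C/N}(φ)`: the isomorphism closure of `P φ` in `C/N`. -/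
def quotientSlicing (N : ObjectProperty C) (P : ℝ → ObjectProperty C) :
    ℝ → ObjectProperty (VerdierQuotient N) :=
  fun φ => (P φ).map N.trW.Q

/-- `P` is adapted to `N`: the semistable factors of objects of `N` lie in `N`, and
`P(I) ∩ N` is a Serre subcategory of `P(I)` for `I = (φ, φ + 1]` and `I = [φ, φ + 1)`. The short
exact sequences of the heart `P(I)` are the distinguished triangles with vertices in `P(I)`. -/
structure IsAdapted (N : ObjectProperty C) (P : ℝ → ObjectProperty C) : Prop where
  restricts : ∀ X : C, N X → ∀ h : HNFiltration P X, ∀ i < h.n, N (h.factor i)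
  serre : ∀ (φ : ℝ) (I : Set ℝ), I = Set.Ioc φ (φ + 1) ∨ I = Set.Ico φ (φ + 1) →
    ∀ T ∈ distTriang C, interval P I T.obj₁ → interval P I T.obj₂ → interval P I T.obj₃ →
      (N T.obj₂ ↔ N T.obj₁ ∧ N T.obj₃)

/-- The locally finite slicing `P` is well-adapted to `N`: it is adapted to `N` and the quotient
slicing is locally finite. -/
structure IsWellAdapted [IsTriangulated C] (N : ObjectProperty C) [N.IsTriangulated]
    (P : ℝ → ObjectProperty C) : Prop where
  isSlicing : IsSlicing P
  isLocallyFinite : IsLocallyFinite P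
  isAdapted : IsAdapted N P
  isLocallyFinite_quotient : IsLocallyFinite (quotientSlicing N P)

/-- The sublattice `Λ_N`: the smallest primitive (saturated) subgroup of `Λ` containing the classes
of the objects of `N`. -/
def saturatedSublattice {Λ : Type w} [AddCommGroup Λ] (cl : K0 C →+ Λ) (N : ObjectProperty C) :
    AddSubgroup Λ :=
  sInf {M : AddSubgroup Λ | (∀ X : C, N X → cl (K0.of X) ∈ M) ∧
    ∀ (k : ℤ) (l : Λ), k ≠ 0 → k • l ∈ M → l ∈ M}

end Quotient

end LaxStability

/-! The source of everything is a positivity property. Inside a heart `P((ψ, ψ + 1])` the charges,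
rotated by `-π ψ`, lie in a cone that contains no nonzero `w` together with `-w`. A sum of such
charges vanishes only if every summand does, so an object of a heart is massless as soon as its
charge is zero (`massless_of_charge_eq_zero`). Masslessness therefore passes to subobjects,
quotients and extensions within each heart.

To leave the heart, write `A * B` for the objects `X` in a triangle `A ⟶ X ⟶ B`; this product is
associative by the octahedral axiom. Let `M` be massless with phases in `(ψ - 1, ψ]` and let `E` lie
in the heart `(ψ, ψ + 1]`. An object of `M * E` is the fibre of a map `E ⟶ M[1]` in the heart. The
kernel and cokernel of that map rewrite it as an object of `K * R`, with `K` in the heart and `R`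
massless (`exists_heart_swap`). Phases more than one apart commute because the extension splits
(`far_swap`). Sorting by these two moves shows that massless objects are closed under extensions
(`massless_ext`) and that `N * P(> ψ)` is contained in `P(> ψ) * N` (`massless_ext_upper`). Closure
under retracts comes from functoriality of truncation, so `N` is thick.

The second inclusion gives the vanishing of morphisms in `C/N`: the source of a right fraction out
of a semistable object of phase `> ψ` lies in `N * P(> ψ)`, so a map from it to an object of phase
`ψ` factors through `N`. The remaining slicing axioms descend directly
(`isSlicing_quotientSlicing`). Semistable objects of zero charge die in `C/N`, so the charges of the
surviving ones are nonzero. With local finiteness of the quotient slicing this is the first claim.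

For the second claim, Jordan–Hölder filtrations reduce the support property to stable objects.
Massless ones have class zero in `Λ/Λ_N`, and both sides behave well on extensions because the
charges lie on one ray (`quotient_support`). Local finiteness of the quotient slicing then follows
from the support property: bounded charge leaves finitely many lattice classes for strict subobjects
(`isLocallyFinite_of_support`). -/

namespace LaxStability

open ObjectProperty (extensionProduct)
open scoped ZeroObject

/-! ### Harder–Narasimhan filtrations and extension products -/

section HarderNarasimhan

variable {C : Type u} [Category.{v} C] [Preadditive C] [HasZeroObject C] [HasShift C ℤ]
  [∀ n : ℤ, (shiftFunctor C n).Additive] [Pretriangulated C]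

/-- The empty filtration of a zero object. -/
def HNFiltration.ofIsZero (R : ℝ → ObjectProperty C) {X : C} (hX : IsZero X) :
    HNFiltration R X where
  n := 0
  obj _ := X
  factor _ := X
  phase _ := 0
  isZero_obj_zero := hX
  topIso := Iso.refl X
  triangle i hi := absurd hi (by lia)
  semistable i hi := absurd hi (by lia)
  factor_ne_zero i hi := absurd hi (by lia)
  phase_lt i j _ hj := absurd hj (by lia)

/-- Forget the last step of a filtration. -/
def HNFiltration.init {R : ℝ → ObjectProperty C} {X : C} (h : HNFiltration R X) (k : ℕ)
    (hk : k ≤ h.n) : HNFiltration R (h.obj k) where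
  n := k
  obj := h.obj
  factor := h.factor
  phase := h.phase
  isZero_obj_zero := h.isZero_obj_zero
  topIso := Iso.refl _
  triangle i hi := h.triangle i (by lia)
  semistable i hi := h.semistable i (by lia)
  factor_ne_zero i hi := h.factor_ne_zero i (by lia)
  phase_lt i j hij hj := h.phase_lt i j hij (by lia)

/-- Transport of a filtration along an isomorphism. -/
def HNFiltration.ofIso {R : ℝ → ObjectProperty C} {X Y : C} (h : HNFiltration R X) (e : X ≅ Y) :
    HNFiltration R Y where
  n := h.n
  obj := h.obj
  factor := h.factor
  phase := h.phase
  isZero_obj_zero := h.isZero_obj_zero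
  topIso := h.topIso ≪≫ e
  triangle := h.triangle
  semistable := h.semistable
  factor_ne_zero := h.factor_ne_zero
  phase_lt := h.phase_lt

lemma mem_distTriang_of_iso₁ {A A' X B : C} {f : A ⟶ X} {g : X ⟶ B} {h : B ⟶ A⟦(1 : ℤ)⟧}
    (hT : Triangle.mk f g h ∈ distTriang C) (e : A' ≅ A) :
    Triangle.mk (e.hom ≫ f) g (h ≫ e.inv⟦(1 : ℤ)⟧') ∈ distTriang C :=
  isomorphic_distinguished _ hT _ (Triangle.isoMk _ _ e (Iso.refl _) (Iso.refl _)
    (Category.comp_id _) ((Category.comp_id _).trans (Category.id_comp _).symm) (by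
      change (h ≫ e.inv⟦1⟧') ≫ e.hom⟦1⟧' = 𝟙 B ≫ h
      simp [← Functor.map_comp]))

lemma mem_distTriang_of_iso₂ {A X X' B : C} {f : A ⟶ X} {g : X ⟶ B} {h : B ⟶ A⟦(1 : ℤ)⟧}
    (hT : Triangle.mk f g h ∈ distTriang C) (e : X' ≅ X) :
    Triangle.mk (f ≫ e.inv) (e.hom ≫ g) h ∈ distTriang C :=
  isomorphic_distinguished _ hT _ (Triangle.isoMk _ _ (Iso.refl _) e (Iso.refl _)
    (by change (f ≫ e.inv) ≫ e.hom = 𝟙 A ≫ f; simp) (Category.comp_id _) (by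
      change h ≫ (𝟙 A)⟦1⟧' = 𝟙 B ≫ h
      simp))

/-- Extend a filtration by one step. -/
def HNFiltration.snoc {R : ℝ → ObjectProperty C} {A X B : C} (h : HNFiltration R A) {ψ : ℝ}
    (hψ : ∀ i < h.n, ψ < h.phase i) {f : A ⟶ X} {g : X ⟶ B} {δ : B ⟶ A⟦(1 : ℤ)⟧}
    (hT : Triangle.mk f g δ ∈ distTriang C) (hB : R ψ B) (hB0 : ¬ IsZero B) :
    HNFiltration R X where
  n := h.n + 1
  obj i := if i ≤ h.n then h.obj i else X
  factor i := if i < h.n then h.factor i else B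
  phase i := if i < h.n then h.phase i else ψ
  isZero_obj_zero := by simpa using h.isZero_obj_zero
  topIso := eqToIso (by simp)
  triangle i hi := by
    rcases Nat.lt_succ_iff_lt_or_eq.1 hi with hi | rfl
    · rw [if_pos hi.le, if_pos (Nat.succ_le_of_lt hi), if_pos hi]
      exact h.triangle i hi
    · rw [if_pos le_rfl, if_neg (Nat.not_succ_le_self _), if_neg (lt_irrefl _)]
      -- Stage `h.n` stays `h.obj h.n` rather than `A`, so the new triangle is transported along
      -- `h.topIso`.
      exact ⟨_, _, _, mem_distTriang_of_iso₁ hT h.topIso⟩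
  semistable i hi := by
    rcases Nat.lt_succ_iff_lt_or_eq.1 hi with hi | rfl
    · simpa only [hi, if_true] using h.semistable i hi
    · simpa only [lt_irrefl, if_false] using hB
  factor_ne_zero i hi := by
    rcases Nat.lt_succ_iff_lt_or_eq.1 hi with hi | rfl
    · simpa only [hi, if_true] using h.factor_ne_zero i hi
    · simpa only [lt_irrefl, if_false] using hB0
  phase_lt i j hij hj := by
    rcases Nat.lt_succ_iff_lt_or_eq.1 hj with hj | rfl
    · simpa only [hj, hij.trans hj, if_true] using h.phase_lt i j hij hj
    · simpa only [hij, lt_irrefl, if_true, if_false] using hψ i hij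

variable {R : ℝ → ObjectProperty C} {S T : Set ℝ}

instance : (interval R S).IsClosedUnderIsomorphisms where
  of_iso e h := ⟨h.choose.ofIso e, h.choose_spec⟩

lemma interval_of_isZero {X : C} (hX : IsZero X) : interval R S X :=
  ⟨.ofIsZero R hX, fun _ hi ↦ absurd hi (Nat.not_lt_zero _)⟩

instance : (interval R S).ContainsZero where
  exists_zero := ⟨0, isZero_zero C, interval_of_isZero (isZero_zero C)⟩

lemma interval_mono (hST : S ⊆ T) : interval R S ≤ interval R T :=
  fun _ ⟨h, hS⟩ ↦ ⟨h, fun i hi ↦ hST (hS i hi)⟩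

lemma interval_of_subset {X : C} (hX : interval R S X) (hST : S ⊆ T) : interval R T X :=
  interval_mono hST _ hX

/-- The factor `B` may be zero here, although filtrations have nonzero factors: then `A ≅ X` and no
step is added. -/
lemma interval_snoc {ψ : ℝ} (hψ : ψ ∈ S) {A X B : C} {f : A ⟶ X} {g : X ⟶ B}
    {δ : B ⟶ A⟦(1 : ℤ)⟧} (hT : Triangle.mk f g δ ∈ distTriang C)
    (hA : interval R (S ∩ Set.Ioi ψ) A) (hB : R ψ B) : interval R S X := by
  obtain ⟨h, hS⟩ := hA
  by_cases hB0 : IsZero B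
  · have : IsIso f := (Triangle.isZero₃_iff_isIso₁ _ hT).1 hB0
    exact ObjectProperty.prop_of_iso _ (asIso f) ⟨h, fun i hi ↦ (hS i hi).1⟩
  · refine ⟨h.snoc (fun i hi ↦ (hS i hi).2) hT hB hB0, fun i hi ↦ ?_⟩
    rcases Nat.lt_succ_iff_lt_or_eq.1 hi with hi | rfl
    · simpa [HNFiltration.snoc, hi] using (hS i hi).1
    · simpa [HNFiltration.snoc] using hψ

lemma interval_of_mem {ψ : ℝ} (hψ : ψ ∈ S) {X : C} (hX : R ψ X) : interval R S X :=
  interval_snoc hψ (contractible_distinguished₁ X) (interval_of_isZero (isZero_zero C)) hX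

/-- Dévissage by removing the factor of lowest phase. The motive depends on `S` so that the
induction remembers that the other phases are larger than the removed one. -/
lemma interval_induction {motive : Set ℝ → C → Prop}
    (zero : ∀ S X, IsZero X → motive S X)
    (ext : ∀ (S : Set ℝ) (ψ : ℝ) (A X B : C) (f : A ⟶ X) (g : X ⟶ B) (δ : B ⟶ A⟦(1 : ℤ)⟧),
      ψ ∈ S → Triangle.mk f g δ ∈ distTriang C → interval R (S ∩ Set.Ioi ψ) A → R ψ B →
      ¬ IsZero B → motive (S ∩ Set.Ioi ψ) A → motive S X)
    (S : Set ℝ) (X : C) (hX : interval R S X) : motive S X := by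
  obtain ⟨h, hS⟩ := hX
  induction hn : h.n generalizing S X with
  | zero => exact zero S X (h.isZero_obj_zero.of_iso (h.topIso.symm ≪≫ eqToIso (by rw [hn])))
  | succ k ih =>
    have hk : k < h.n := by lia
    obtain ⟨f, g, δ, hT⟩ := h.triangle k hk
    have hS' : ∀ i < k, h.phase i ∈ S ∩ Set.Ioi (h.phase k) :=
      fun i hi ↦ ⟨hS i (by lia), h.phase_lt i k hi hk⟩
    exact ext S (h.phase k) _ _ _ _ _ _ (hS k hk)
      (mem_distTriang_of_iso₂ hT (h.topIso.symm ≪≫ eqToIso (by rw [hn])))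
      ⟨h.init k hk.le, hS'⟩ (h.semistable k hk) (h.factor_ne_zero k hk)
      (ih _ _ (h.init k hk.le) hS' rfl)

lemma interval_le_of_le {R' : ℝ → ObjectProperty C} (hR : ∀ φ, R φ ≤ R' φ) :
    interval R S ≤ interval R' S := fun X hX ↦ by
  refine interval_induction (R := R) (motive := fun S X ↦ interval R' S X)
    (fun S X ↦ interval_of_isZero) ?_ S X hX
  intro S ψ A X B f g δ hψ hT _ hB _ hA
  exact interval_snoc hψ hT hA (hR _ _ hB)

lemma eq_zero_of_interval (horth : ∀ φ ψ (X Y : C), ψ < φ → R φ X → R ψ Y → ∀ f : X ⟶ Y, f = 0)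
    (hST : ∀ s ∈ S, ∀ t ∈ T, t < s) {X Y : C} (hX : interval R S X) (hY : interval R T Y)
    (f : X ⟶ Y) : f = 0 := by
  have key : ∀ φ (B : C), R φ B → ∀ T Y, interval R T Y → (∀ t ∈ T, t < φ) →
      ∀ f : B ⟶ Y, f = 0 := by
    intro φ B hB
    refine interval_induction (fun S X hX _ f ↦ hX.eq_of_tgt _ _) ?_
    intro T ψ A Y B' f g δ hψ hT _ hB' _ ih hlt k
    obtain ⟨l, rfl⟩ := Triangle.coyoneda_exact₂ _ hT k
      (horth φ ψ _ _ (hlt ψ hψ) hB hB' _)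
    rw [ih (fun t ht ↦ hlt t ht.1) l]
    exact zero_comp
  revert Y
  refine interval_induction (motive := fun S X ↦ (∀ s ∈ S, ∀ t ∈ T, t < s) → ∀ {Y : C},
    interval R T Y → ∀ f : X ⟶ Y, f = 0) (fun S X hX _ _ _ f ↦ hX.eq_of_src _ _) ?_ S X hX hST
  intro S ψ A X B f g δ hψ hT _ hB _ ih hlt Y hY k
  obtain ⟨l, rfl⟩ := Triangle.yoneda_exact₂ _ hT k (ih (fun s hs ↦ hlt s hs.1) hY _)
  rw [key ψ B hB T Y hY (fun t ht ↦ hlt ψ hψ t ht) l]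
  exact comp_zero

variable [IsTriangulated C]

/-- Associativity of the extension product attaches the factors of the right-hand object one at a
time. Only the order of phases matters, so `R` need not be a slicing. In `key` the right-hand object
is fixed by the property `(· = Y)` to allow induction on it. -/
lemma extensionProduct_interval_le (hST : ∀ s ∈ S, ∀ t ∈ T, t < s) :
    extensionProduct (interval R S) (interval R T) ≤ interval R (S ∪ T) := by
  have key : ∀ T Y, interval R T Y → (∀ s ∈ S, ∀ t ∈ T, t < s) →
      extensionProduct (interval R S) (· = Y) ≤ interval R (S ∪ T) := by
    refine interval_induction ?_ ?_
    · rintro T Y hY _ X ⟨A, _, f, g, h, hT, hA, rfl⟩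
      have : IsIso f := (Triangle.isZero₃_iff_isIso₁ _ hT).1 hY
      exact ObjectProperty.prop_of_iso _ (asIso f) (interval_mono Set.subset_union_left _ hA)
    · rintro T ψ c Y a f g δ hψ hT _ ha _ ih hlt X ⟨A, _, u, v, w, hT', hA, rfl⟩
      have : extensionProduct (extensionProduct (interval R S) (· = c)) (· = a) X := by
        rw [ObjectProperty.extensionProduct_assoc]
        exact ⟨_, _, _, _, _, hT', hA, _, _, _, _, _, hT, rfl, rfl⟩
      obtain ⟨A', _, u', v', w', hT'', hA', rfl⟩ := this
      refine interval_snoc (Or.inr hψ) hT'' ?_ ha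
      refine interval_mono ?_ _ (ih (fun s hs t ht ↦ hlt s hs t ht.1) _ hA')
      rintro x (hx | hx)
      · exact ⟨Or.inl hx, hlt x hx ψ hψ⟩
      · exact ⟨Or.inr hx.1, hx.2⟩
  rintro X ⟨A, B, f, g, h, hT, hA, hB⟩
  exact key T B hB hST X ⟨A, B, f, g, h, hT, hA, rfl⟩

/-- A filtration is cut where its phases leave `U`. A general upper set covers open and closed cuts
at once. -/
lemma interval_le_extensionProduct {U : Set ℝ} (hU : IsUpperSet U) :
    interval R S ≤ extensionProduct (interval R (S ∩ U)) (interval R (S \ U)) := by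
  refine fun X hX ↦ interval_induction (R := R) (motive := fun S X ↦
    extensionProduct (interval R (S ∩ U)) (interval R (S \ U)) X) ?_ ?_ S X hX
  · intro S X hX
    exact ObjectProperty.le_extensionProduct_left _ _ (interval_of_isZero hX)
  · rintro S ψ c X a f g δ hψ hT hc ha _ ih
    by_cases hψU : ψ ∈ U
    · refine ObjectProperty.le_extensionProduct_left _ _ (interval_snoc (S := S ∩ U) ⟨hψ, hψU⟩ hT ?_ ha)
      refine interval_mono ?_ _ hc
      exact fun x hx ↦ ⟨⟨hx.1, hU (le_of_lt hx.2) hψU⟩, hx.2⟩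
    · have : extensionProduct (interval R (S ∩ U))
          (extensionProduct (interval R ((S ∩ Set.Ioi ψ) \ U)) (· = a)) X := by
        rw [← ObjectProperty.extensionProduct_assoc]
        refine ⟨_, _, _, _, _, hT, ?_, rfl⟩
        refine ObjectProperty.monotone_extensionProduct_left _ (interval_mono ?_) _ ih
        exact fun x hx ↦ ⟨hx.1.1, hx.2⟩
      refine ObjectProperty.monotone_extensionProduct_right _ ?_ _ this
      rintro Y ⟨A, _, u, v, w, hT', hA, rfl⟩
      refine interval_snoc (S := S \ U) ⟨hψ, hψU⟩ hT' (interval_mono ?_ _ hA) ha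
      exact fun x hx ↦ ⟨⟨hx.1.1, hx.2⟩, hx.1.2⟩

lemma interval_le_extensionProduct_of_subset {U T' : Set ℝ} (hU : IsUpperSet U) (hT : S ∩ U ⊆ T)
    (hT' : S \ U ⊆ T') : interval R S ≤ extensionProduct (interval R T) (interval R T') :=
  ((interval_le_extensionProduct hU).trans
    (ObjectProperty.monotone_extensionProduct_left _ (interval_mono hT))).trans
    (ObjectProperty.monotone_extensionProduct_right _ (interval_mono hT'))

end HarderNarasimhan

end LaxStability

namespace LaxStability

open ObjectProperty (extensionProduct)
open scoped ZeroObject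

/-! ### Functoriality of truncation triangles -/

section Truncation

variable {C : Type u} [Category.{v} C] [Preadditive C] [HasZeroObject C] [HasShift C ℤ]
  [∀ n : ℤ, (shiftFunctor C n).Additive] [Pretriangulated C]
  {A X B A' X' B' : C} {u : A ⟶ X} {v : X ⟶ B} {w : B ⟶ A⟦(1 : ℤ)⟧}
  {u' : A' ⟶ X'} {v' : X' ⟶ B'} {w' : B' ⟶ A'⟦(1 : ℤ)⟧}

lemma exists_truncation_map (hT : Triangle.mk u v w ∈ distTriang C)
    (hT' : Triangle.mk u' v' w' ∈ distTriang C) (h0 : ∀ k : A ⟶ B', k = 0) (f : X ⟶ X') :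
    ∃ (a : A ⟶ A') (b : B ⟶ B'), a ≫ u' = u ≫ f ∧ v ≫ b = f ≫ v' := by
  obtain ⟨a, ha⟩ : ∃ a : A ⟶ A', u ≫ f = a ≫ u' :=
    Triangle.coyoneda_exact₂ _ hT' (u ≫ f) (h0 _)
  obtain ⟨b, hb⟩ : ∃ b : B ⟶ B', f ≫ v' = v ≫ b :=
    Triangle.yoneda_exact₂ _ hT (f ≫ v') (h0 _)
  exact ⟨a, b, ha.symm, hb.symm⟩

lemma truncation_map_unique₁ (hT' : Triangle.mk u' v' w' ∈ distTriang C)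
    (h1 : ∀ k : A⟦(1 : ℤ)⟧ ⟶ B', k = 0) {a b : A ⟶ A'} (h : a ≫ u' = b ≫ u') : a = b := by
  obtain ⟨k, hk⟩ : ∃ k : A⟦(1 : ℤ)⟧ ⟶ B', (a - b)⟦(1 : ℤ)⟧' = k ≫ w' :=
    Triangle.coyoneda_exact₁ _ hT' ((a - b)⟦(1 : ℤ)⟧') (by
      change (a - b)⟦(1 : ℤ)⟧' ≫ u'⟦(1 : ℤ)⟧' = 0
      rw [← Functor.map_comp, Preadditive.sub_comp, h, sub_self, Functor.map_zero])
  rw [h1 k, zero_comp] at hk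
  exact sub_eq_zero.1 ((shiftFunctor C (1 : ℤ)).map_injective (hk.trans (Functor.map_zero _ _ _).symm))

lemma truncation_map_unique₃ (hT : Triangle.mk u v w ∈ distTriang C)
    (h1 : ∀ k : A⟦(1 : ℤ)⟧ ⟶ B', k = 0) {a b : B ⟶ B'} (h : v ≫ a = v ≫ b) : a = b := by
  obtain ⟨k, hk⟩ : ∃ k : A⟦(1 : ℤ)⟧ ⟶ B', a - b = w ≫ k :=
    Triangle.yoneda_exact₃ _ hT (a - b) (by
      change v ≫ (a - b) = 0
      rw [Preadditive.comp_sub, h, sub_self])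
  rw [h1 k, comp_zero] at hk
  exact sub_eq_zero.1 hk

lemma retract_of_truncation (hT : Triangle.mk u v w ∈ distTriang C)
    (hT' : Triangle.mk u' v' w' ∈ distTriang C)
    (h0 : ∀ k : A ⟶ B', k = 0) (h0' : ∀ k : A' ⟶ B, k = 0)
    (h1 : ∀ k : A⟦(1 : ℤ)⟧ ⟶ B, k = 0) (r : Retract X X') :
    Nonempty (Retract A A') ∧ Nonempty (Retract B B') := by
  obtain ⟨a, b, ha, hb⟩ := exists_truncation_map hT hT' h0 r.i
  obtain ⟨a', b', ha', hb'⟩ := exists_truncation_map hT' hT h0' r.r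
  refine ⟨⟨a, a', truncation_map_unique₁ hT h1 ?_⟩, ⟨b, b', truncation_map_unique₃ hT h1 ?_⟩⟩
  · rw [Category.assoc, ha', reassoc_of% ha, r.retract, Category.comp_id, Category.id_comp]
  · rw [reassoc_of% hb, hb', r.retract_assoc, Category.comp_id]

lemma iso_of_truncation (hT : Triangle.mk u v w ∈ distTriang C)
    (hT' : Triangle.mk u' v' w' ∈ distTriang C)
    (h0 : ∀ k : A ⟶ B', k = 0) (h0' : ∀ k : A' ⟶ B, k = 0)
    (h1 : ∀ k : A⟦(1 : ℤ)⟧ ⟶ B, k = 0) (h1' : ∀ k : A'⟦(1 : ℤ)⟧ ⟶ B', k = 0) (e : X ≅ X') :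
    Nonempty (A ≅ A') ∧ Nonempty (B ≅ B') := by
  obtain ⟨a, b, ha, hb⟩ := exists_truncation_map hT hT' h0 e.hom
  obtain ⟨a', b', ha', hb'⟩ := exists_truncation_map hT' hT h0' e.inv
  refine ⟨⟨a, a', truncation_map_unique₁ hT h1 ?_, truncation_map_unique₁ hT' h1' ?_⟩,
    ⟨b, b', truncation_map_unique₃ hT h1 ?_, truncation_map_unique₃ hT' h1' ?_⟩⟩
  · rw [Category.assoc, ha', reassoc_of% ha, e.hom_inv_id, Category.comp_id, Category.id_comp]
  · rw [Category.assoc, ha, reassoc_of% ha', e.inv_hom_id, Category.comp_id, Category.id_comp]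
  · rw [reassoc_of% hb, hb', e.hom_inv_id_assoc, Category.comp_id]
  · rw [reassoc_of% hb', hb, e.inv_hom_id_assoc, Category.comp_id]

end Truncation

/-! ### Uniqueness of filtrations and closure properties of intervals -/

section Slicing

variable {C : Type u} [Category.{v} C] [Preadditive C] [HasZeroObject C] [HasShift C ℤ]
  [∀ n : ℤ, (shiftFunctor C n).Additive] [Pretriangulated C]
  {P R : ℝ → ObjectProperty C} {S T U W : Set ℝ}

lemma interval_shift (n : ℤ) (hR : ∀ φ X, R φ X → R (φ + n) (X⟦n⟧)) {X : C}
    (hX : interval R S X) : interval R {x | x - n ∈ S} (X⟦n⟧) := by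
  refine interval_induction (R := R) (motive := fun S X ↦ interval R {x | x - n ∈ S} (X⟦n⟧))
    (fun S X hX ↦ interval_of_isZero (Functor.map_isZero _ hX)) ?_ S X hX
  intro S ψ A X B f g δ hψ hT _ hB _ ih
  refine interval_snoc (ψ := ψ + n) (by simpa using hψ) (Triangle.shift_distinguished _ hT n)
    (interval_mono ?_ _ ih) (hR _ _ hB)
  intro x hx
  exact ⟨hx.1, Set.mem_Ioi.2 (lt_sub_iff_add_lt.1 hx.2)⟩

lemma isZero_of_interval_empty {X : C} (hX : interval R ∅ X) : IsZero X := by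
  refine interval_induction (R := R) (motive := fun S X ↦ S = ∅ → IsZero X)
    (fun _ _ h _ ↦ h) ?_ ∅ X hX rfl
  rintro S ψ _ _ _ _ _ _ hψ _ _ _ _ _ rfl
  exact absurd hψ (Set.notMem_empty _)

lemma mem_of_interval_subset_singleton [∀ φ, (R φ).IsClosedUnderIsomorphisms] {ψ : ℝ}
    (hS : S ⊆ {ψ}) {X : C} (hX : interval R S X) (h0 : ¬ IsZero X) : ψ ∈ S ∧ R ψ X := by
  refine interval_induction (R := R)
    (motive := fun S X ↦ S ⊆ {ψ} → ¬ IsZero X → ψ ∈ S ∧ R ψ X)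
    (fun _ _ h _ h' ↦ absurd h h') ?_ S X hX hS h0
  rintro S φ A X B f g δ hφ hT hA hB _ _ hS h0
  obtain rfl : φ = ψ := hS hφ
  refine ⟨hφ, ?_⟩
  have hA0 : IsZero A := isZero_of_interval_empty (R := R) (interval_mono (fun x hx ↦ by
    have h1 : x = φ := hS hx.1
    exact absurd (Set.mem_Ioi.1 hx.2) (h1 ▸ lt_irrefl _)) _ hA)
  have : IsIso g := (Triangle.isZero₁_iff_isIso₂ _ hT).1 hA0
  exact ObjectProperty.prop_of_iso _ (asIso g).symm hB

namespace IsSlicing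

variable (hP : IsSlicing P)
include hP

lemma shift_int (n : ℤ) (φ : ℝ) (X : C) : P (φ + n) (X⟦n⟧) ↔ P φ X := by
  have := hP.isoClosed
  induction n using Int.induction_on generalizing φ with
  | zero =>
    simp only [Int.cast_zero, add_zero]
    exact ObjectProperty.prop_iff_of_iso _ ((shiftFunctorZero C ℤ).app X)
  | succ n ih =>
    refine Iff.trans ?_ (ih φ)
    rw [← hP.shift_iff (φ + (n : ℤ))]
    push_cast
    rw [← add_assoc]
    exact ObjectProperty.prop_iff_of_iso _ ((shiftFunctorAdd' C (n : ℤ) 1 _ rfl).app X)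
  | pred n ih =>
    refine Iff.trans ?_ (ih φ)
    rw [← hP.shift_iff (φ + ((-n - 1 : ℤ) : ℝ))]
    have : φ + ((-n - 1 : ℤ) : ℝ) + 1 = φ + ((-n : ℤ) : ℝ) := by push_cast; ring
    rw [this]
    exact ObjectProperty.prop_iff_of_iso _
      ((shiftFunctorAdd' C (-n - 1 : ℤ) 1 (-n) (by ring)).app X).symm

lemma interval_shift (n : ℤ) {X : C} (hX : interval P S X) :
    interval P {x | x - n ∈ S} (X⟦n⟧) :=
  LaxStability.interval_shift n (fun φ X ↦ (hP.shift_int n φ X).2) hX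

lemma eq_zero_of_interval (hST : ∀ s ∈ S, ∀ t ∈ T, t < s) {X Y : C} (hX : interval P S X)
    (hY : interval P T Y) (f : X ⟶ Y) : f = 0 :=
  LaxStability.eq_zero_of_interval hP.hom_eq_zero hST hX hY f

lemma eq_zero_of_interval_shift (hST : ∀ s ∈ S, ∀ t ∈ T, t < s + 1) {X Y : C}
    (hX : interval P S X) (hY : interval P T Y) (f : X⟦(1 : ℤ)⟧ ⟶ Y) : f = 0 := by
  refine hP.eq_zero_of_interval ?_ (hP.interval_shift 1 hX) hY f
  intro s hs t ht
  have := hST _ hs t ht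
  push_cast at this
  linarith

lemma iso_of_truncation (hST : ∀ s ∈ S, ∀ t ∈ T, t < s)
    {A X B A' X' B' : C} {u : A ⟶ X} {v : X ⟶ B} {w : B ⟶ A⟦(1 : ℤ)⟧}
    {u' : A' ⟶ X'} {v' : X' ⟶ B'} {w' : B' ⟶ A'⟦(1 : ℤ)⟧}
    (hT : Triangle.mk u v w ∈ distTriang C) (hT' : Triangle.mk u' v' w' ∈ distTriang C)
    (hA : interval P S A) (hA' : interval P S A') (hB : interval P T B) (hB' : interval P T B')
    (e : X ≅ X') : Nonempty (A ≅ A') ∧ Nonempty (B ≅ B') := by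
  have h1 : ∀ s ∈ S, ∀ t ∈ T, t < s + 1 := fun s hs t ht ↦ (hST s hs t ht).trans (lt_add_one s)
  exact LaxStability.iso_of_truncation hT hT' (hP.eq_zero_of_interval hST hA hB')
    (hP.eq_zero_of_interval hST hA' hB) (hP.eq_zero_of_interval_shift h1 hA hB)
    (hP.eq_zero_of_interval_shift h1 hA' hB') e

variable [IsTriangulated C]

/-- Truncation triangles are unique up to isomorphism, so the last factor of `h` can be compared
with a truncation of the `R`-filtration. Taking `R = P` shows that phases do not depend on the
filtration; taking the massless slices for `R` shows the same for masslessness. -/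
theorem hn_unique (hR : ∀ φ, R φ ≤ P φ) [∀ φ, (R φ).IsClosedUnderIsomorphisms] {X : C}
    (hX : interval R S X) (h : HNFiltration P X) :
    ∀ i < h.n, h.phase i ∈ S ∧ R (h.phase i) (h.factor i) := by
  induction hn : h.n generalizing S X with
  | zero => exact fun i hi ↦ absurd hi (Nat.not_lt_zero _)
  | succ k ih =>
    have hk : k < h.n := by lia
    obtain ⟨f, g, δ, hT⟩ := h.triangle k hk
    set ψ := h.phase k with hψ
    have hc : interval P (Set.Ioi ψ) (h.obj k) :=
      ⟨h.init k hk.le, fun i hi ↦ h.phase_lt i k hi hk⟩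
    have ha : interval P {ψ} (h.factor k) := interval_of_mem (Set.mem_singleton ψ) (h.semistable k hk)
    obtain ⟨A, B, u, v, w, hT', hA, hB⟩ :=
      interval_le_extensionProduct (isUpperSet_Ioi ψ) _ hX
    have hR' : ∀ S, interval R S ≤ interval P S := fun S ↦ interval_le_of_le hR
    obtain ⟨⟨e₁⟩, ⟨e₂⟩⟩ := hP.iso_of_truncation (S := Set.Ioi ψ) (T := Set.Iic ψ)
      (fun s hs t ht ↦ lt_of_le_of_lt ht hs) hT' hT
      (interval_mono Set.inter_subset_right _ (hR' _ _ hA)) hc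
      (interval_mono (fun x hx ↦ Set.mem_Iic.2 (not_lt.1 hx.2)) _ (hR' _ _ hB))
      (interval_mono (by simp) _ ha) (h.topIso.symm ≪≫ eqToIso (by rw [hn]))
    intro i hi
    rcases Nat.lt_succ_iff_lt_or_eq.1 hi with hi | rfl
    · have := ih (ObjectProperty.prop_of_iso _ e₁ hA) (h.init k hk.le) rfl i hi
      exact ⟨this.1.1, this.2⟩
    · have hB' := ObjectProperty.prop_of_iso _ e₂ hB
      -- So far the phases in the `R`-filtration of this factor are only known to be at most `ψ`; a
      -- second truncation, at `[ψ, ∞)`, isolates the phase `ψ`.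
      obtain ⟨A', B', u', v', w', hT'', hA', hB''⟩ :=
        interval_le_extensionProduct (isUpperSet_Ici ψ) _ hB'
      obtain ⟨⟨e₃⟩, -⟩ := hP.iso_of_truncation (S := Set.Ici ψ) (T := Set.Iio ψ)
        (fun s hs t ht ↦ lt_of_lt_of_le ht hs) hT'' (contractible_distinguished (h.factor i))
        (interval_mono Set.inter_subset_right _ (hR' _ _ hA')) (interval_mono (by simp) _ ha)
        (interval_mono (fun x hx ↦ Set.mem_Iio.2 (not_le.1 hx.2)) _ (hR' _ _ hB''))
        (interval_of_isZero (isZero_zero C)) (Iso.refl _)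
      have := mem_of_interval_subset_singleton (ψ := ψ)
        (fun x hx ↦ le_antisymm (not_lt.1 hx.1.2) hx.2)
        (ObjectProperty.prop_of_iso _ e₃ hA') (h.factor_ne_zero i hk)
      exact ⟨this.1.1.1, this.2⟩

lemma interval_inter {X : C} (hS : interval P S X) (hT : interval P T X) :
    interval P (S ∩ T) X := by
  have := hP.isoClosed
  obtain ⟨h, hS⟩ := hS
  exact ⟨h, fun i hi ↦ ⟨hS i hi, (hP.hn_unique (fun _ ↦ le_rfl) hT h i hi).1⟩⟩

/-- Open and half-open intervals and single phases are all differences of upper sets; closure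
properties reduce to those of `P(U)` and `P(Wᶜ)`. -/
lemma interval_sdiff_iff {X : C} :
    interval P (U \ W) X ↔ interval P U X ∧ interval P Wᶜ X :=
  ⟨fun h ↦ ⟨interval_mono Set.sdiff_subset _ h, interval_mono (fun _ h ↦ h.2) _ h⟩,
    fun h ↦ hP.interval_inter h.1 h.2⟩

omit [IsTriangulated C] in
lemma interval_univ (X : C) : interval P Set.univ X :=
  ⟨(hP.exists_hn X).some, fun _ _ ↦ trivial⟩

lemma exists_truncation (hU : IsUpperSet U) (X : C) :
    ∃ (A B : C) (u : A ⟶ X) (v : X ⟶ B) (w : B ⟶ A⟦(1 : ℤ)⟧),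
      Triangle.mk u v w ∈ distTriang C ∧ interval P U A ∧ interval P Uᶜ B := by
  obtain ⟨A, B, u, v, w, hT, hA, hB⟩ := interval_le_extensionProduct hU _ (hP.interval_univ X)
  exact ⟨A, B, u, v, w, hT, interval_mono Set.inter_subset_right _ hA,
    interval_mono (fun _ h ↦ h.2) _ hB⟩

omit hP [IsTriangulated C] in
lemma lt_of_isUpperSet (hU : IsUpperSet U) : ∀ s ∈ U, ∀ t ∈ Uᶜ, t < s :=
  fun _ hs _ ht ↦ not_le.1 fun hle ↦ ht (hU hle hs)

/-- Orthogonality kills the map from `X` to its lower truncation, which must then be zero. With its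
dual, this description makes closure under extensions and retracts formal. -/
lemma interval_iff_of_isUpperSet (hU : IsUpperSet U) {X : C} :
    interval P U X ↔ ∀ B, interval P Uᶜ B → ∀ f : X ⟶ B, f = 0 := by
  refine ⟨fun hX B hB f ↦ hP.eq_zero_of_interval (lt_of_isUpperSet hU) hX hB f, fun h ↦ ?_⟩
  obtain ⟨A, B, u, v, w, hT, hA, hB⟩ := hP.exists_truncation hU X
  have hv : v = 0 := h B hB v
  have hw : 𝟙 B = 0 := by
    obtain ⟨k, hk⟩ : ∃ k : A⟦(1 : ℤ)⟧ ⟶ B, 𝟙 B = w ≫ k :=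
      Triangle.yoneda_exact₃ _ hT (𝟙 B) (by change v ≫ _ = 0; rw [hv, zero_comp])
    rw [hk, hP.eq_zero_of_interval_shift
      (fun s hs t ht ↦ (lt_of_isUpperSet hU s hs t ht).trans (lt_add_one s)) hA hB k, comp_zero]
  have : IsIso u := (Triangle.isZero₃_iff_isIso₁ _ hT).1 ((IsZero.iff_id_eq_zero _).2 hw)
  exact ObjectProperty.prop_of_iso _ (asIso u) hA

lemma interval_compl_iff_of_isUpperSet (hU : IsUpperSet U) {X : C} :
    interval P Uᶜ X ↔ ∀ A, interval P U A → ∀ f : A ⟶ X, f = 0 := by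
  refine ⟨fun hX A hA f ↦ hP.eq_zero_of_interval (lt_of_isUpperSet hU) hA hX f, fun h ↦ ?_⟩
  obtain ⟨A, B, u, v, w, hT, hA, hB⟩ := hP.exists_truncation hU X
  have hu : u = 0 := h A hA u
  have hw : 𝟙 A = 0 := truncation_map_unique₁ hT
    (hP.eq_zero_of_interval_shift
      (fun s hs t ht ↦ (lt_of_isUpperSet hU s hs t ht).trans (lt_add_one s)) hA hB)
    (by rw [hu, comp_zero, comp_zero])
  have : IsIso v := (Triangle.isZero₁_iff_isIso₂ _ hT).1 ((IsZero.iff_id_eq_zero _).2 hw)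
  exact ObjectProperty.prop_of_iso _ (asIso v).symm hB

lemma ext_upper (hU : IsUpperSet U) {T : Triangle C} (hT : T ∈ distTriang C)
    (h₁ : interval P U T.obj₁) (h₃ : interval P U T.obj₃) : interval P U T.obj₂ := by
  rw [hP.interval_iff_of_isUpperSet hU] at *
  intro B hB f
  obtain ⟨k, rfl⟩ := Triangle.yoneda_exact₂ _ hT f (h₁ B hB _)
  rw [h₃ B hB k, comp_zero]

lemma ext_lower (hU : IsUpperSet U) {T : Triangle C} (hT : T ∈ distTriang C)
    (h₁ : interval P Uᶜ T.obj₁) (h₃ : interval P Uᶜ T.obj₃) : interval P Uᶜ T.obj₂ := by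
  rw [hP.interval_compl_iff_of_isUpperSet hU] at *
  intro A hA f
  obtain ⟨k, rfl⟩ := Triangle.coyoneda_exact₂ _ hT f (h₃ A hA _)
  rw [h₁ A hA k, zero_comp]

lemma ext_sdiff (hU : IsUpperSet U) (hW : IsUpperSet W) {T : Triangle C}
    (hT : T ∈ distTriang C) (h₁ : interval P (U \ W) T.obj₁) (h₃ : interval P (U \ W) T.obj₃) :
    interval P (U \ W) T.obj₂ := by
  rw [hP.interval_sdiff_iff] at *
  exact ⟨hP.ext_upper hU hT h₁.1 h₃.1, hP.ext_lower hW hT h₁.2 h₃.2⟩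

lemma retract_sdiff (hU : IsUpperSet U) (hW : IsUpperSet W) {X Y : C} (r : Retract X Y)
    (hY : interval P (U \ W) Y) : interval P (U \ W) X := by
  rw [hP.interval_sdiff_iff] at *
  refine ⟨?_, ?_⟩
  · rw [hP.interval_iff_of_isUpperSet hU] at *
    intro B hB f
    rw [← Category.id_comp f, ← r.retract, Category.assoc, hY.1 B hB (r.r ≫ f), comp_zero]
  · rw [hP.interval_compl_iff_of_isUpperSet hW] at *
    intro B hB f
    rw [← Category.comp_id f, ← r.retract, ← Category.assoc, hY.2 B hB (f ≫ r.i), zero_comp]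

omit [IsTriangulated C] in
lemma interval_singleton {φ : ℝ} : interval P (Set.Ici φ \ Set.Ioi φ) = P φ := by
  have := hP.isoClosed
  have := hP.containsZero φ
  ext X
  refine ⟨fun h ↦ ?_, fun h ↦ interval_of_mem (by simp) h⟩
  by_cases hX : IsZero X
  · exact ObjectProperty.prop_of_isZero _ hX
  · exact (mem_of_interval_subset_singleton
      (fun x hx ↦ le_antisymm (not_lt.1 hx.2) hx.1) h hX).2

end IsSlicing

end Slicing

end LaxStability

namespace LaxStability

open scoped ZeroObject

/-! ### Kernels and strict monomorphisms in short intervals -/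

section QuasiAbelian

variable {C : Type u} [Category.{v} C] [Preadditive C] [HasZeroObject C] [HasShift C ℤ]
  [∀ n : ℤ, (shiftFunctor C n).Additive] [Pretriangulated C] [IsTriangulated C]
  {P : ℝ → ObjectProperty C} {U W : Set ℝ}

/-- The kernel `K` and the coimage `I` of a morphism `g : E ⟶ Z` in a subcategory `P(U \ W)` for an
interval `U \ W` of length at most `1`. -/
lemma IsSlicing.exists_kernel (hP : IsSlicing P) (hU : IsUpperSet U) (hW : IsUpperSet W)
    (hWU : W ⊆ U) (hUW : ∀ x ∈ U, x + 1 ∈ W) {F E Z : C} {i : F ⟶ E} {g : E ⟶ Z}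
    {δ : Z ⟶ F⟦(1 : ℤ)⟧} (hT : Triangle.mk i g δ ∈ distTriang C)
    (hE : interval P (U \ W) E) (hZ : interval P (U \ W) Z) :
    ∃ (K I R : C) (u : K ⟶ F) (v : F ⟶ R) (w : R ⟶ K⟦(1 : ℤ)⟧)
      (p : E ⟶ I) (q : I ⟶ K⟦(1 : ℤ)⟧) (r : R ⟶ I) (s : I ⟶ Z) (t : Z ⟶ R⟦(1 : ℤ)⟧),
      interval P (U \ W) K ∧ interval P (U \ W) I ∧ interval P ({x | x + 1 ∈ U} \ U) R ∧
      Triangle.mk u v w ∈ distTriang C ∧ Triangle.mk (u ≫ i) p q ∈ distTriang C ∧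
      Triangle.mk r s t ∈ distTriang C := by
  have hU1 : IsUpperSet {x : ℝ | x + 1 ∈ U} := fun a b hab ha ↦ hU (by linarith) ha
  have hUx : ∀ x ∈ U, x + 1 ∈ U := fun x hx ↦ hU (by linarith) hx
  have hsub : U ⊆ {x : ℝ | x + 1 ∈ U} := hUx
  have hZ' := hP.interval_shift (-1) hZ
  -- The fibre `F` is an extension of `E` by `Z[-1]`, and its truncation `K` to `U` is the kernel.
  -- The octahedron for `K ⟶ F ⟶ E` fits the remainder `R` into a triangle with `I` and `Z`.
  obtain ⟨K, R, u, v, w, hTK, hK, hR⟩ := hP.exists_truncation hU F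
  obtain ⟨I, p, q, hTI⟩ := distinguished_cocone_triangle (u ≫ i)
  have o := Triangulated.someOctahedron rfl hTK hT hTI
  have hFW : interval P Wᶜ F := hP.ext_lower hW (inv_rot_of_distTriang _ hT)
    (interval_of_subset hZ' (fun x hx hxW ↦ hx.2 (by
      push_cast; rw [sub_neg_eq_add]; exact hUW x (hWU hxW))))
    (interval_mono (fun x hx ↦ hx.2) _ hE)
  have hFU : interval P {x | x + 1 ∈ U} F := hP.ext_upper hU1 (inv_rot_of_distTriang _ hT)
    (interval_mono (fun x hx ↦ by
      have := hx.1; push_cast at this; rwa [sub_neg_eq_add] at this) _ hZ')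
    (interval_mono (fun x hx ↦ hUx x hx.1) _ hE)
  have hKW : interval P Wᶜ K := hP.ext_lower hW (inv_rot_of_distTriang _ hTK)
    (interval_of_subset (hP.interval_shift (-1) hR) (fun x hx hxW ↦ hx (by
      push_cast; rw [sub_neg_eq_add]; exact hUx x (hWU hxW)))) hFW
  have hK1 := hP.interval_shift 1 hK
  have hRU : interval P {x | x + 1 ∈ U} R := hP.ext_upper hU1 (rot_of_distTriang _ hTK) hFU
    (interval_mono (fun x hx ↦ by
      have : x - 1 ∈ U := by simpa using hx
      exact hU (by linarith) this) _ hK1)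
  have hIU : interval P U I := hP.ext_upper hU (rot_of_distTriang _ hTI)
    (interval_mono Set.sdiff_subset _ hE) (interval_mono (fun x hx ↦ by
      have : x - 1 ∈ U := by simpa using hx
      exact hU (by linarith) this) _ hK1)
  have hIW : interval P Wᶜ I := hP.ext_lower hW o.mem
    (interval_mono (Set.compl_subset_compl.2 hWU) _ hR) (interval_mono (fun _ h ↦ h.2) _ hZ)
  exact ⟨K, I, R, u, v, w, p, q, _, _, _, hP.interval_sdiff_iff.2 ⟨hK, hKW⟩,
    hP.interval_sdiff_iff.2 ⟨hIU, hIW⟩, hP.interval_sdiff_iff.2 ⟨hRU, hR⟩, hTK, hTI, o.mem⟩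

/-- A strict monomorphism is the kernel of some `g`, hence isomorphic to the kernel `K ⟶ E` built
from the fibre of `g`, whose cone `I` stays in the interval. -/
lemma IsSlicing.exists_cone_of_isStrictMono (hP : IsSlicing P) (hU : IsUpperSet U)
    (hW : IsUpperSet W) (hWU : W ⊆ U) (hUW : ∀ x ∈ U, x + 1 ∈ W) {Q : ObjectProperty C}
    (hQ : Q = interval P (U \ W)) {Y E : Q.FullSubcategory} {f : Y ⟶ E} (hf : IsStrictMono f) :
    ∃ (I : C) (g : E.obj ⟶ I) (δ : I ⟶ Y.obj⟦(1 : ℤ)⟧),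
      Q I ∧ Triangle.mk f.hom g δ ∈ distTriang C := by
  subst hQ
  obtain ⟨⟨Z, g, hfg, hl⟩⟩ := hf
  obtain ⟨F, i, δ, hT⟩ := distinguished_cocone_triangle₁ g.hom
  obtain ⟨K, I, R, u, v, w, p, q, _, _, _, hK, hI, hR, hTK, hTI, -⟩ :=
    hP.exists_kernel hU hW hWU hUW hT E.property Z.property
  have hmono : ∀ {a b : K ⟶ K}, a ≫ u ≫ i = b ≫ u ≫ i → a = b := fun h ↦
    truncation_map_unique₁ hTI (hP.eq_zero_of_interval_shift (S := U) (T := Wᶜ)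
      (fun s hs t ht ↦ not_le.1 fun hle ↦ ht (hW hle (hUW s hs)))
      (interval_mono Set.sdiff_subset _ hK) (interval_mono (fun _ h ↦ h.2) _ hI)) h
  have hfm : Mono f := ⟨fun a b h ↦ Fork.IsLimit.hom_ext hl h⟩
  have hig : i ≫ g.hom = 0 := comp_distTriang_mor_zero₁₂ _ hT
  let K' : (interval P (U \ W)).FullSubcategory := ⟨K, hK⟩
  obtain ⟨a, ha⟩ : ∃ a : K' ⟶ Y, a ≫ f = ObjectProperty.homMk (u ≫ i) :=
    ⟨_, (KernelFork.IsLimit.lift' hl (ObjectProperty.homMk (u ≫ i) : K' ⟶ E) (by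
      ext
      change (u ≫ i) ≫ g.hom = 0
      rw [Category.assoc, hig, comp_zero])).2⟩
  have ha' : a.hom ≫ f.hom = u ≫ i := congrArg (fun t ↦ t.hom) ha
  obtain ⟨b, hb⟩ : ∃ b : Y.obj ⟶ F, f.hom = b ≫ i :=
    Triangle.coyoneda_exact₂ _ hT f.hom (congrArg (fun t ↦ t.hom) hfg)
  obtain ⟨c, rfl⟩ : ∃ c : Y.obj ⟶ K, b = c ≫ u :=
    Triangle.coyoneda_exact₂ _ hTK b (hP.eq_zero_of_interval
      (IsSlicing.lt_of_isUpperSet hU) (interval_mono Set.sdiff_subset _ Y.property)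
      (interval_mono (fun _ h ↦ h.2) _ hR) _)
  have hc : c ≫ u ≫ i = f.hom := by rw [hb, Category.assoc]
  let e : Y.obj ≅ K := ⟨c, a.hom, by
    have : (ObjectProperty.homMk (c ≫ a.hom) : Y ⟶ Y) = 𝟙 Y := by
      rw [← cancel_mono f]
      ext
      change (c ≫ a.hom) ≫ f.hom = 𝟙 _ ≫ f.hom
      rw [Category.assoc, ha', hc, Category.id_comp]
    exact congrArg (fun t ↦ t.hom) this, hmono (by
      rw [Category.assoc, hc, ha', Category.id_comp])⟩
  refine ⟨I, p, q ≫ e.inv⟦(1 : ℤ)⟧', hI, ?_⟩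
  rw [← hc]
  exact mem_distTriang_of_iso₁ hTI e

omit [IsTriangulated C] in
-- The long exact sequence makes `f` a weak kernel of `g`; it is monic because there are no nonzero
-- maps `A[1] ⟶ I` when the interval has length at most one.
lemma IsSlicing.isStrictMono_of_distTriang (hP : IsSlicing P) 
    (hW : IsUpperSet W) (hUW : ∀ x ∈ U, x + 1 ∈ W) {Q : ObjectProperty C}
    (hQ : Q = interval P (U \ W)) {Y E : Q.FullSubcategory} (f : Y ⟶ E) {I : C} (hI : Q I)
    {g : E.obj ⟶ I} {δ : I ⟶ Y.obj⟦(1 : ℤ)⟧} (hT : Triangle.mk f.hom g δ ∈ distTriang C) :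
    IsStrictMono f := by
  subst hQ
  have hfg : f.hom ≫ g = 0 := comp_distTriang_mor_zero₁₂ _ hT
  have hm : Mono f := ⟨fun {A} a b h ↦ by
    ext
    exact truncation_map_unique₁ hT (hP.eq_zero_of_interval_shift (S := U) (T := Wᶜ)
      (fun s hs t ht ↦ not_le.1 fun hle ↦ ht (hW hle (hUW s hs)))
      (interval_mono Set.sdiff_subset _ A.property) (interval_mono (fun _ h ↦ h.2) _ hI))
      (congrArg (fun t ↦ t.hom) h)⟩
  have hlift : ∀ {A : (interval P (U \ W)).FullSubcategory} (k : A ⟶ E),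
      k ≫ (ObjectProperty.homMk g : E ⟶ ⟨I, hI⟩) = 0 → ∃ l : A ⟶ Y, l ≫ f = k := by
    intro A k hk
    obtain ⟨l, hl⟩ := Triangle.coyoneda_exact₂ _ hT k.hom (congrArg (fun t ↦ t.hom) hk)
    exact ⟨ObjectProperty.homMk l, by ext; exact hl.symm⟩
  exact ⟨{
    Z := ⟨I, hI⟩
    g := ObjectProperty.homMk g
    w := by ext; exact hfg
    isLimit := KernelFork.IsLimit.ofι f _ (fun k hk ↦ (hlift k hk).choose)
      (fun k hk ↦ (hlift k hk).choose_spec)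
      (fun k hk m hm ↦ by rw [← cancel_mono f, hm, (hlift k hk).choose_spec]) }⟩

end QuasiAbelian

end LaxStability

namespace LaxStability

open ObjectProperty (extensionProduct extensionProduct_assoc monotone_extensionProduct_left
  monotone_extensionProduct_right)
open scoped ZeroObject

/-! ### Additive functions and split extensions -/

section TriangleAdditive

variable {C : Type u} [Category.{v} C] [Preadditive C] [HasZeroObject C] [HasShift C ℤ]
  [∀ n : ℤ, (shiftFunctor C n).Additive] [Pretriangulated C] {G : Type*} [AddCommGroup G]

/-- A function on objects that is additive on distinguished triangles. -/
def TriangleAdditive (z : C → G) : Prop := ∀ T ∈ distTriang C, z T.obj₂ = z T.obj₁ + z T.obj₃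

lemma K0.of_add : TriangleAdditive (K0.of (C := C)) := fun T hT ↦ by
  have h : FreeAbelianGroup.of T.obj₂ -
      (FreeAbelianGroup.of T.obj₁ + FreeAbelianGroup.of T.obj₃) ∈ AddSubgroup.closure
    {x : FreeAbelianGroup C | ∃ T ∈ distTriang C, x = FreeAbelianGroup.of T.obj₂ -
      (FreeAbelianGroup.of T.obj₁ + FreeAbelianGroup.of T.obj₃)} :=
    AddSubgroup.subset_closure ⟨T, hT, rfl⟩
  have := (QuotientAddGroup.eq_zero_iff _).2 h
  exact sub_eq_zero.1 this

namespace TriangleAdditive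

lemma comp {G' : Type*} [AddCommGroup G'] {z : C → G} (hz : TriangleAdditive z) (f : G →+ G') :
    TriangleAdditive (fun X ↦ f (z X)) :=
  fun T hT ↦ by simp only [hz T hT, map_add]

variable {z : C → G} (hz : TriangleAdditive z)
include hz

lemma add {A X B : C} {f : A ⟶ X} {g : X ⟶ B} {h : B ⟶ A⟦(1 : ℤ)⟧}
    (hT : Triangle.mk f g h ∈ distTriang C) : z X = z A + z B :=
  hz _ hT

lemma zero : z (0 : C) = 0 := by
  simpa using hz.add (contractible_distinguished (0 : C))

lemma eq_of_iso {X Y : C} (e : X ≅ Y) : z X = z Y := by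
  have := hz.add (mem_distTriang_of_iso₁ (contractible_distinguished Y) e)
  rw [hz.zero, add_zero] at this
  exact this.symm

lemma of_isZero {X : C} (hX : IsZero X) : z X = 0 := by
  rw [hz.eq_of_iso hX.isoZero, hz.zero]

lemma shift_one (X : C) : z (X⟦(1 : ℤ)⟧) = - z X := by
  have h := hz.add (rot_of_distTriang _ (contractible_distinguished X))
  change z (0 : C) = z X + z (X⟦(1 : ℤ)⟧) at h
  rw [hz.zero] at h
  exact (neg_eq_of_add_eq_zero_right h.symm).symm

lemma shift_eq_zero (n : ℤ) {X : C} (hX : z X = 0) : z (X⟦n⟧) = 0 := by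
  induction n using Int.induction_on with
  | zero => rw [hz.eq_of_iso ((shiftFunctorZero C ℤ).app X)]; exact hX
  | succ n ih =>
    rw [hz.eq_of_iso ((shiftFunctorAdd' C (n : ℤ) 1 _ rfl).app X)]
    exact (hz.shift_one _).trans (neg_eq_zero.2 ih)
  | pred n ih =>
    rw [hz.eq_of_iso ((shiftFunctorAdd' C (-n - 1 : ℤ) 1 (-n) (by ring)).app X)] at ih
    exact neg_eq_zero.1 ((hz.shift_one _).symm.trans ih)

end TriangleAdditive

/-- The connecting morphism vanishes, so the triangle splits and its summands can be exchanged. -/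
lemma extensionProduct_swap {A B : ObjectProperty C}
    (h : ∀ X Y, B X → A Y → ∀ f : X ⟶ Y⟦(1 : ℤ)⟧, f = 0) :
    extensionProduct A B ≤ extensionProduct B A := by
  rintro X ⟨Y, Z, f, g, δ, hT, hY, hZ⟩
  obtain ⟨e, -, -⟩ := exists_iso_binaryBiproduct_of_distTriang _ hT (h _ _ hZ hY δ)
  exact ObjectProperty.prop_of_iso _ ((biprod.braiding Y Z).symm ≪≫ e.symm)
    ⟨Z, Y, _, _, _, binaryBiproductTriangle_distinguished Z Y, hZ, hY⟩

end TriangleAdditive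

/-! ### Positivity of charges in a half-plane -/

section HalfPlane

/-- The rays of argument in `(0, π]`, together with the origin. -/
def halfPlane : AddSubmonoid ℂ where
  carrier := {w | 0 < w.im ∨ w.im = 0 ∧ w.re ≤ 0}
  zero_mem' := by simp
  add_mem' := by
    rintro a b (ha | ha) (hb | hb)
    · exact Or.inl (by rw [Complex.add_im]; linarith)
    · exact Or.inl (by rw [Complex.add_im]; linarith)
    · exact Or.inl (by rw [Complex.add_im]; linarith)
    · exact Or.inr ⟨by rw [Complex.add_im]; linarith, by rw [Complex.add_re]; linarith⟩

lemma eq_zero_of_mem_halfPlane {w : ℂ} (h : w ∈ halfPlane) (h' : -w ∈ halfPlane) : w = 0 := by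
  have h1 : 0 < w.im ∨ w.im = 0 ∧ w.re ≤ 0 := h
  have h2 : 0 < (-w).im ∨ (-w).im = 0 ∧ (-w).re ≤ 0 := h'
  rw [Complex.neg_im, Complex.neg_re] at h2
  apply Complex.ext
  · rw [Complex.zero_re]
    rcases h1 with h1 | h1 <;> rcases h2 with h2 | h2 <;> linarith
  · rw [Complex.zero_im]
    rcases h1 with h1 | h1 <;> rcases h2 with h2 | h2 <;> linarith

lemma rotate_ray (m φ ψ : ℝ) :
    Complex.exp (-(Complex.I * Real.pi * ψ)) * (m * Complex.exp (Complex.I * Real.pi * φ)) =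
      ⟨m * Real.cos (Real.pi * (φ - ψ)), m * Real.sin (Real.pi * (φ - ψ))⟩ := by
  rw [mul_left_comm, ← Complex.exp_add]
  have : -(Complex.I * Real.pi * ψ) + Complex.I * Real.pi * φ =
      ((Real.pi * (φ - ψ) : ℝ) : ℂ) * Complex.I := by push_cast; ring
  rw [this]
  apply Complex.ext
  · rw [Complex.re_ofReal_mul, Complex.exp_ofReal_mul_I_re]
  · rw [Complex.im_ofReal_mul, Complex.exp_ofReal_mul_I_im]

lemma ray_mem_halfPlane {m φ ψ : ℝ} (hm : 0 ≤ m) (h : φ ∈ Set.Ioc ψ (ψ + 1)) :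
    Complex.exp (-(Complex.I * Real.pi * ψ)) * (m * Complex.exp (Complex.I * Real.pi * φ)) ∈
      halfPlane := by
  rw [rotate_ray]
  rcases hm.eq_or_lt with rfl | hm
  · exact Or.inr ⟨by simp, by simp⟩
  rcases h.2.eq_or_lt with rfl | h2
  · right
    simp [hm.le]
  · left
    refine mul_pos hm (Real.sin_pos_of_pos_of_lt_pi ?_ ?_)
    · exact mul_pos Real.pi_pos (sub_pos.2 h.1)
    · have := mul_lt_mul_of_pos_left (show φ - ψ < 1 by linarith) Real.pi_pos
      simpa using this

end HalfPlane

/-! ### The massless subcategory is thick -/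

section Massless

variable {C : Type u} [Category.{v} C] [Preadditive C] [HasZeroObject C] [HasShift C ℤ]
  [∀ n : ℤ, (shiftFunctor C n).Additive] [Pretriangulated C]

/-- The massless semistable objects of a given phase. -/
def masslessSlicing (P : ℝ → ObjectProperty C) (z : C → ℂ) (φ : ℝ) : ObjectProperty C :=
  fun X ↦ P φ X ∧ z X = 0

/-- A slicing `P` together with an additive function `z` whose values on `P φ` lie on the closed
ray of argument `π φ`. -/
structure IsLaxCharge (P : ℝ → ObjectProperty C) (z : C → ℂ) : Prop where
  isSlicing : IsSlicing P
  add : TriangleAdditive z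
  ray : ∀ φ X, P φ X → ∃ m : ℝ, 0 ≤ m ∧ z X = m * Complex.exp (Complex.I * Real.pi * φ)

namespace IsLaxCharge

variable {P : ℝ → ObjectProperty C} {z : C → ℂ} {S T : Set ℝ} (h : IsLaxCharge P z)
include h

lemma isClosedUnderIsomorphisms (φ : ℝ) :
    (masslessSlicing P z φ).IsClosedUnderIsomorphisms where
  of_iso e hX := by
    have := h.isSlicing.isoClosed φ
    exact ⟨(P φ).prop_of_iso e hX.1, by rw [← h.add.eq_of_iso e, hX.2]⟩

omit h in
lemma massless_le : interval (masslessSlicing P z) S ≤ interval P S :=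
  interval_le_of_le fun _ _ hX ↦ hX.1

lemma charge_eq_zero {X : C} (hX : interval (masslessSlicing P z) S X) : z X = 0 := by
  refine interval_induction (R := masslessSlicing P z) (motive := fun _ X ↦ z X = 0)
    (fun _ _ hX ↦ h.add.of_isZero hX) ?_ S X hX
  intro S ψ A X B f g δ _ hT _ hB _ ih
  rw [h.add.add hT, ih, hB.2, add_zero]

lemma charge_mem_halfPlane {ψ : ℝ} {X : C} (hX : interval P S X) (hS : S ⊆ Set.Ioc ψ (ψ + 1)) :
    Complex.exp (-(Complex.I * Real.pi * ψ)) * z X ∈ halfPlane := by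
  refine interval_induction (R := P) (motive := fun S X ↦ S ⊆ Set.Ioc ψ (ψ + 1) →
    Complex.exp (-(Complex.I * Real.pi * ψ)) * z X ∈ halfPlane) ?_ ?_ S X hX hS
  · intro _ X hX _
    rw [h.add.of_isZero hX, mul_zero]
    exact zero_mem _
  · intro S φ A X B f g δ hφ hT _ hB _ ih hS
    rw [h.add.add hT, mul_add]
    obtain ⟨m, hm, hzB⟩ := h.ray φ B hB
    exact add_mem (ih fun x hx ↦ hS hx.1) (hzB ▸ ray_mem_halfPlane hm (hS hφ))

/-- The rotated charges of all factors lie in `halfPlane`, where a vanishing sum forces each summand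
to vanish. -/
lemma massless_of_charge_eq_zero {ψ : ℝ} {X : C} (hX : interval P S X)
    (hS : S ⊆ Set.Ioc ψ (ψ + 1)) (hz : z X = 0) : interval (masslessSlicing P z) S X := by
  refine interval_induction (R := P) (motive := fun S X ↦ S ⊆ Set.Ioc ψ (ψ + 1) → z X = 0 →
    interval (masslessSlicing P z) S X) (fun _ _ hX _ _ ↦ interval_of_isZero hX) ?_ S X hX hS hz
  intro S φ A X B f g δ hφ hT hA hB _ ih hS hX
  rw [h.add.add hT] at hX
  have hA' := h.charge_mem_halfPlane hA (ψ := ψ) (fun x hx ↦ hS hx.1)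
  have hB' := h.charge_mem_halfPlane (interval_of_mem (S := S) hφ hB) (ψ := ψ) hS
  have hzA : z A = 0 := by
    have := eq_zero_of_mem_halfPlane hA' (by
      rwa [← mul_neg, neg_eq_of_add_eq_zero_right hX])
    exact (mul_eq_zero.1 this).resolve_left (Complex.exp_ne_zero _)
  have hzB : z B = 0 := by rwa [hzA, zero_add] at hX
  exact interval_snoc hφ hT (ih (fun x hx ↦ hS hx.1) hzA) ⟨hB, hzB⟩

lemma massless_shift (n : ℤ) {X : C} (hX : interval (masslessSlicing P z) S X) :
    interval (masslessSlicing P z) {x | x - n ∈ S} (X⟦n⟧) :=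
  interval_shift n (fun φ X hX ↦ ⟨(h.isSlicing.shift_int n φ X).2 hX.1,
    h.add.shift_eq_zero n hX.2⟩) hX

variable [IsTriangulated C]

omit [IsTriangulated C] h in
lemma Ioi_sdiff_subset (ψ : ℝ) : Set.Ioi ψ \ Set.Ioi (ψ + 1) ⊆ Set.Ioc ψ (ψ + 1) :=
  fun _ hx ↦ ⟨hx.1, not_lt.1 hx.2⟩

/-- Rotating the triangle presents `X` as the fibre of a map `E ⟶ M[1]` in the heart. Its kernel is
`K` and its cokernel is `R[1]`, a quotient of a massless object. The equality of charges is kept so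
that `K` is massless whenever `E` is. -/
lemma exists_heart_swap {ψ : ℝ} {M X E : C} {f : M ⟶ X} {g : X ⟶ E} {δ : E ⟶ M⟦(1 : ℤ)⟧}
    (hT : Triangle.mk f g δ ∈ distTriang C)
    (hM : interval (masslessSlicing P z) (Set.Ioi (ψ - 1) \ Set.Ioi ψ) M)
    (hE : interval P (Set.Ioi ψ \ Set.Ioi (ψ + 1)) E) :
    ∃ (K R : C) (u : K ⟶ X) (v : X ⟶ R) (w : R ⟶ K⟦(1 : ℤ)⟧), Triangle.mk u v w ∈ distTriang C ∧
      interval P (Set.Ioi ψ \ Set.Ioi (ψ + 1)) K ∧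
      interval (masslessSlicing P z) (Set.Ioi (ψ - 1) \ Set.Ioi ψ) R ∧ z K = z E := by
  have hM1 : interval P (Set.Ioi ψ \ Set.Ioi (ψ + 1)) (M⟦(1 : ℤ)⟧) := by
    refine interval_of_subset (h.isSlicing.interval_shift 1 (massless_le _ hM)) fun x hx ↦ ?_
    have h1 : ψ - 1 < x - ((1 : ℤ) : ℝ) := hx.1
    have h2 : x - ((1 : ℤ) : ℝ) ≤ ψ := not_lt.1 hx.2
    push_cast at h1 h2
    exact ⟨by change ψ < x; linarith, by change ¬ (ψ + 1 < x); linarith⟩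
  have hrot : Triangle.mk g δ (-f⟦(1 : ℤ)⟧') ∈ distTriang C := rot_of_distTriang _ hT
  obtain ⟨K, I, R, u, v, w, p, q, r, s, t, hK, hI, hR, h1, h2, h3⟩ :=
    h.isSlicing.exists_kernel (isUpperSet_Ioi ψ) (isUpperSet_Ioi (ψ + 1))
      (Set.Ioi_subset_Ioi (by linarith)) (fun x hx ↦ Set.mem_Ioi.2 (add_lt_add_left hx 1))
      hrot hE hM1
  have hR' : interval P (Set.Ioi (ψ - 1) \ Set.Ioi ψ) R :=
    interval_of_subset hR fun x hx ↦ ⟨Set.mem_Ioi.2 (sub_lt_iff_lt_add.2 hx.1), hx.2⟩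
  have hzM : z (M⟦(1 : ℤ)⟧) = 0 := h.add.shift_eq_zero 1 (h.charge_eq_zero hM)
  have hzI : z I = z R := by rw [h.add.add h3, hzM, add_zero]
  -- In the heart `I` is a subobject of `M[1]` with quotient `R[1]`. Both `z I` and `-z R`, once
  -- rotated, lie in `halfPlane`, while `z I = z R`.
  have hzR : z R = 0 := by
    have hI' := h.charge_mem_halfPlane hI (Ioi_sdiff_subset ψ)
    have hR1 := h.charge_mem_halfPlane (ψ := ψ) (h.isSlicing.interval_shift 1 hR')
      (fun x hx ↦ by
        have h1 : ψ - 1 < x - ((1 : ℤ) : ℝ) := hx.1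
        have h2 : x - ((1 : ℤ) : ℝ) ≤ ψ := not_lt.1 hx.2
        push_cast at h1 h2
        exact ⟨by linarith, by linarith⟩)
    rw [h.add.shift_one, mul_neg] at hR1
    rw [hzI] at hI'
    exact (mul_eq_zero.1 (eq_zero_of_mem_halfPlane hI' hR1)).resolve_left (Complex.exp_ne_zero _)
  refine ⟨K, R, u, v, w, h1, hK, h.massless_of_charge_eq_zero hR' (ψ := ψ - 1) ?_ hzR, ?_⟩
  · exact fun x hx ↦ ⟨hx.1, by rw [sub_add_cancel]; exact not_lt.1 hx.2⟩
  · rw [h.add.add h2, hzI, hzR, add_zero]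

lemma heart_swap (ψ : ℝ) :
    extensionProduct (interval (masslessSlicing P z) (Set.Ioi (ψ - 1) \ Set.Ioi ψ))
      (interval P (Set.Ioi ψ \ Set.Ioi (ψ + 1))) ≤
    extensionProduct (interval P (Set.Ioi ψ \ Set.Ioi (ψ + 1)))
      (interval (masslessSlicing P z) (Set.Ioi (ψ - 1) \ Set.Ioi ψ)) := by
  rintro X ⟨M, E, f, g, δ, hT, hM, hE⟩
  obtain ⟨K, R, u, v, w, hT', hK, hR, -⟩ := h.exists_heart_swap hT hM hE
  exact ⟨K, R, u, v, w, hT', hK, hR⟩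

lemma heart_swap_massless (ψ : ℝ) :
    extensionProduct (interval (masslessSlicing P z) (Set.Ioi (ψ - 1) \ Set.Ioi ψ))
      (interval (masslessSlicing P z) (Set.Ioi ψ \ Set.Ioi (ψ + 1))) ≤
    extensionProduct (interval (masslessSlicing P z) (Set.Ioi ψ \ Set.Ioi (ψ + 1)))
      (interval (masslessSlicing P z) (Set.Ioi (ψ - 1) \ Set.Ioi ψ)) := by
  rintro X ⟨M, E, f, g, δ, hT, hM, hE⟩
  obtain ⟨K, R, u, v, w, hT', hK, hR, hz⟩ := h.exists_heart_swap hT hM (massless_le _ hE)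
  exact ⟨K, R, u, v, w, hT', h.massless_of_charge_eq_zero hK (Ioi_sdiff_subset ψ)
    (hz.trans (h.charge_eq_zero hE)), hR⟩

omit [IsTriangulated C] in
-- If every phase in `T` exceeds every phase in `S` by more than one, the connecting morphism goes
-- from higher to lower phase.
lemma far_swap {R R' : ℝ → ObjectProperty C} (hR : ∀ φ, R φ ≤ P φ) (hR' : ∀ φ, R' φ ≤ P φ)
    (hST : ∀ s ∈ S, ∀ t ∈ T, s + 1 < t) :
    extensionProduct (interval R S) (interval R' T) ≤
      extensionProduct (interval R' T) (interval R S) :=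
  extensionProduct_swap fun X Y hX hY f ↦ by
    refine h.isSlicing.eq_zero_of_interval ?_ (interval_le_of_le hR' _ hX)
      (h.isSlicing.interval_shift 1 (interval_le_of_le hR _ hY)) f
    intro t ht s hs
    have := hST _ hs t ht
    push_cast at this
    linarith

lemma massless_heart_ext (ψ : ℝ) :
    extensionProduct (interval (masslessSlicing P z) (Set.Ioi ψ \ Set.Ioi (ψ + 1)))
      (interval (masslessSlicing P z) (Set.Ioi ψ \ Set.Ioi (ψ + 1))) ≤
      interval (masslessSlicing P z) (Set.Ioi ψ \ Set.Ioi (ψ + 1)) := by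
  rintro X ⟨A, B, f, g, δ, hT, hA, hB⟩
  refine h.massless_of_charge_eq_zero ?_ (Ioi_sdiff_subset ψ) (by
    rw [h.add.add hT, h.charge_eq_zero hA, h.charge_eq_zero hB, add_zero])
  exact h.isSlicing.ext_sdiff (isUpperSet_Ioi _) (isUpperSet_Ioi _) hT
    (massless_le _ hA) (massless_le _ hB)

/-- Split the massless object as `a * b * c * d` by phases, with `b` in the heart of the new factor.
That factor moves left past `d` by a split extension and past `c` by a heart swap, and is absorbed
by `b`. -/
lemma massless_ext_heart (ψ : ℝ) :
    extensionProduct (interval (masslessSlicing P z) Set.univ)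
      (interval (masslessSlicing P z) (Set.Ioi ψ \ Set.Ioi (ψ + 1))) ≤
      interval (masslessSlicing P z) Set.univ := by
  set I := interval (masslessSlicing P z) with hI
  set b := I (Set.Ioi ψ \ Set.Ioi (ψ + 1))
  set c := I (Set.Ioi (ψ - 1) \ Set.Ioi ψ) with hc
  set a := I (Set.Ioi (ψ + 1))
  set d := I (Set.Ioi (ψ - 1))ᶜ
  have h1 : I Set.univ ≤ extensionProduct a (extensionProduct b (extensionProduct c d)) := by
    have h2 : I (Set.Ioi ψ)ᶜ ≤ extensionProduct c d :=
      interval_le_extensionProduct_of_subset (isUpperSet_Ioi (ψ - 1))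
        (fun x hx ↦ ⟨hx.2, hx.1⟩) (fun x hx ↦ hx.2)
    have h3 : I (Set.Ioi (ψ + 1))ᶜ ≤ extensionProduct b (I (Set.Ioi ψ)ᶜ) :=
      interval_le_extensionProduct_of_subset (isUpperSet_Ioi ψ)
        (fun x hx ↦ ⟨hx.2, hx.1⟩) (fun x hx ↦ hx.2)
    have h4 : I Set.univ ≤ extensionProduct a (I (Set.Ioi (ψ + 1))ᶜ) :=
      interval_le_extensionProduct_of_subset (isUpperSet_Ioi (ψ + 1))
        (fun x hx ↦ hx.2) (fun x hx ↦ hx.2)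
    exact h4.trans (monotone_extensionProduct_right _
      (h3.trans (monotone_extensionProduct_right _ h2)))
  have hdb : extensionProduct d b ≤ extensionProduct b d :=
    h.far_swap (fun _ _ hX ↦ hX.1) (fun _ _ hX ↦ hX.1) fun s hs t ht ↦ by
      have h1 : s ≤ ψ - 1 := not_lt.1 hs
      have h2 : ψ < t := ht.1
      linarith
  have hcb : extensionProduct c b ≤ extensionProduct b c := h.heart_swap_massless ψ
  have hbb : extensionProduct b b ≤ b := h.massless_heart_ext ψ
  have hcd : extensionProduct c d ≤ I (Set.Ioi ψ)ᶜ :=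
    (extensionProduct_interval_le fun s hs t ht ↦
      (not_lt.1 ht).trans_lt hs.1).trans (interval_mono (by
        rintro x (hx | hx)
        · exact hx.2
        · have h1 : x ≤ ψ - 1 := not_lt.1 hx
          change ¬ (ψ < x)
          linarith))
  have hbcd : extensionProduct b (I (Set.Ioi ψ)ᶜ) ≤ I (Set.Ioi (ψ + 1))ᶜ :=
    (extensionProduct_interval_le fun s hs t ht ↦
      (not_lt.1 ht).trans_lt hs.1).trans (interval_mono (by
        rintro x (hx | hx)
        · exact hx.2
        · have h1 : x ≤ ψ := not_lt.1 hx
          change ¬ (ψ + 1 < x)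
          linarith))
  have ha : extensionProduct a (I (Set.Ioi (ψ + 1))ᶜ) ≤ I Set.univ :=
    (extensionProduct_interval_le fun s hs t ht ↦
      (not_lt.1 ht).trans_lt hs).trans (interval_mono (Set.subset_univ _))
  calc extensionProduct (I Set.univ) b
      ≤ extensionProduct (extensionProduct a (extensionProduct b (extensionProduct c d))) b :=
        monotone_extensionProduct_left _ h1
    _ = extensionProduct a (extensionProduct b (extensionProduct c (extensionProduct d b))) := by
        simp only [extensionProduct_assoc]
    _ ≤ extensionProduct a (extensionProduct b (extensionProduct c (extensionProduct b d))) :=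
        monotone_extensionProduct_right _ (monotone_extensionProduct_right _
          (monotone_extensionProduct_right _ hdb))
    _ = extensionProduct a (extensionProduct b (extensionProduct (extensionProduct c b) d)) := by
        simp only [extensionProduct_assoc]
    _ ≤ extensionProduct a (extensionProduct b (extensionProduct (extensionProduct b c) d)) :=
        monotone_extensionProduct_right _ (monotone_extensionProduct_right _
          (monotone_extensionProduct_left _ hcb))
    _ = extensionProduct a (extensionProduct (extensionProduct b b) (extensionProduct c d)) := by
        simp only [extensionProduct_assoc]
    _ ≤ extensionProduct a (extensionProduct b (extensionProduct c d)) :=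
        monotone_extensionProduct_right _ (monotone_extensionProduct_left _ hbb)
    _ ≤ extensionProduct a (I (Set.Ioi (ψ + 1))ᶜ) :=
        monotone_extensionProduct_right _ ((monotone_extensionProduct_right _ hcd).trans hbcd)
    _ ≤ I Set.univ := ha

lemma massless_ext :
    extensionProduct (interval (masslessSlicing P z) Set.univ)
      (interval (masslessSlicing P z) Set.univ) ≤ interval (masslessSlicing P z) Set.univ := by
  have key : ∀ T Y, interval (masslessSlicing P z) T Y →
      extensionProduct (interval (masslessSlicing P z) Set.univ) (· = Y) ≤
        interval (masslessSlicing P z) Set.univ := by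
    refine interval_induction ?_ ?_
    · rintro T Y hY X ⟨A, _, f, g, δ, hT, hA, rfl⟩
      have : IsIso f := (Triangle.isZero₃_iff_isIso₁ _ hT).1 hY
      exact ObjectProperty.prop_of_iso _ (asIso f) hA
    · rintro T φ c Y a f g δ hφ hT _ ha _ ih X ⟨A, _, u, v, w, hT', hA, rfl⟩
      have : extensionProduct (extensionProduct (interval (masslessSlicing P z) Set.univ)
          (· = c)) (· = a) X := by
        rw [extensionProduct_assoc]
        exact ⟨_, _, _, _, _, hT', hA, _, _, _, _, _, hT, rfl, rfl⟩
      obtain ⟨A', _, u', v', w', hT'', hA', rfl⟩ := this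
      -- The heart `(φ - 1, φ]` is the one with `φ` as its top phase, so it contains the factor.
      refine h.massless_ext_heart (φ - 1) _ ⟨_, _, _, _, _, hT'', ih _ hA', ?_⟩
      exact interval_of_mem (S := Set.Ioi (φ - 1) \ Set.Ioi (φ - 1 + 1)) ⟨sub_one_lt φ, by simp⟩ ha
  rintro X ⟨A, B, f, g, δ, hT, hA, hB⟩
  exact key _ B hB X ⟨A, B, f, g, δ, hT, hA, rfl⟩

lemma massless_isTriangulated : (interval (masslessSlicing P z) Set.univ).IsTriangulated where
  exists_zero := ⟨0, isZero_zero C, interval_of_isZero (isZero_zero C)⟩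
  isStableUnderShiftBy n :=
    { le_shift := fun _ hX ↦ interval_of_subset (h.massless_shift n hX) (Set.subset_univ _) }
  toIsTriangulatedClosed₂ := .mk' fun _ hT h₁ h₃ ↦ h.massless_ext _ ⟨_, _, _, _, _, hT, h₁, h₃⟩

/-- The complement is a retract as well, hence semistable of the same phase. Two nonnegative
multiples of one unit vector with sum zero both vanish. -/
lemma masslessSlicing_of_retract {φ : ℝ} {X Y : C} (r : Retract X Y)
    (hY : masslessSlicing P z φ Y) : masslessSlicing P z φ X := by
  have hP : ∀ {X}, Retract X Y → P φ X := fun {X} r ↦ by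
    have h1 := h.isSlicing.interval_singleton (φ := φ)
    rw [← h1]
    exact h.isSlicing.retract_sdiff (isUpperSet_Ici φ) (isUpperSet_Ioi φ) r (by rw [h1]; exact hY.1)
  refine ⟨hP r, ?_⟩
  obtain ⟨Q, g, δ, hT⟩ := distinguished_cocone_triangle r.i
  have hδ : δ = 0 := (Triangle.mor₃_eq_zero_iff_mono₁ _ hT).2 (by
    change Mono r.i
    infer_instance)
  have hg : Epi g := (Triangle.mor₃_eq_zero_iff_epi₂ _ hT).1 hδ
  have : IsSplitEpi g := isSplitEpi_of_epi g
  obtain ⟨m, hm, hX⟩ := h.ray φ X (hP r)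
  obtain ⟨m', hm', hQ⟩ := h.ray φ Q (hP ⟨section_ g, g, IsSplitEpi.id g⟩)
  have hsum := h.add.add hT
  rw [hY.2, hX, hQ, ← add_mul, zero_eq_mul, or_iff_left (Complex.exp_ne_zero _)] at hsum
  have : m = 0 := by
    have : m + m' = 0 := by exact_mod_cast hsum
    linarith
  rw [hX, this, Complex.ofReal_zero, zero_mul]

/-- Truncation is functorial, so a retract of `Y` is truncated into retracts of the pieces of `Y`;
this reduces to a single phase. -/
lemma massless_of_retract {X Y : C} (r : Retract X Y)
    (hY : interval (masslessSlicing P z) S Y) : interval (masslessSlicing P z) S X := by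
  refine interval_induction (R := masslessSlicing P z) (motive := fun S Y ↦ ∀ X, Retract X Y →
    interval (masslessSlicing P z) S X) ?_ ?_ S Y hY X r
  · intro S Y hY X r
    exact interval_of_isZero ((IsZero.iff_id_eq_zero _).2 (by
      rw [← r.retract, hY.eq_of_tgt r.i 0, zero_comp]))
  · intro S ψ A Y B f g δ hψ hT hA hB _ ih X r
    obtain ⟨A', B', u, v, w, hT', hA', hB'⟩ :=
      h.isSlicing.exists_truncation (isUpperSet_Ioi ψ) X
    have hA0 : interval P (Set.Ioi ψ) A :=
      interval_of_subset (massless_le _ hA) Set.inter_subset_right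
    have hB0 : interval P (Set.Ioi ψ)ᶜ B := interval_of_mem (by simp) hB.1
    have hlt := IsSlicing.lt_of_isUpperSet (isUpperSet_Ioi ψ)
    obtain ⟨⟨rA⟩, ⟨rB⟩⟩ := retract_of_truncation hT' hT
      (h.isSlicing.eq_zero_of_interval hlt hA' hB0) (h.isSlicing.eq_zero_of_interval hlt hA0 hB')
      (h.isSlicing.eq_zero_of_interval_shift
        (fun s hs t ht ↦ (hlt s hs t ht).trans (lt_add_one s)) hA' hB') r
    exact interval_snoc hψ hT' (ih _ rA) (h.masslessSlicing_of_retract rB hB)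

/-- The truncation of an extension of an object of `P(> ψ)` by a massless object is massless. -/
lemma massless_ext_upper (ψ : ℝ) :
    extensionProduct (interval (masslessSlicing P z) Set.univ) (interval P (Set.Ioi ψ)) ≤
      extensionProduct (interval P (Set.Ioi ψ)) (interval (masslessSlicing P z) Set.univ) := by
  set I := interval (masslessSlicing P z) with hI
  set U := interval P (Set.Ioi ψ)
  set U₁ := interval P (Set.Ioi (ψ + 1))
  set b := interval P (Set.Ioi ψ \ Set.Ioi (ψ + 1))
  set c := I (Set.Ioi (ψ - 1) \ Set.Ioi ψ) with hc
  set d := I (Set.Ioi (ψ - 1))ᶜ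
  have h1 : I Set.univ ≤ extensionProduct U (extensionProduct c d) := by
    have h2 : I (Set.Ioi ψ)ᶜ ≤ extensionProduct c d :=
      interval_le_extensionProduct_of_subset (isUpperSet_Ioi (ψ - 1))
        (fun x hx ↦ ⟨hx.2, hx.1⟩) (fun x hx ↦ hx.2)
    have h4 : I Set.univ ≤ extensionProduct (I (Set.Ioi ψ)) (I (Set.Ioi ψ)ᶜ) :=
      interval_le_extensionProduct_of_subset (isUpperSet_Ioi ψ)
        (fun x hx ↦ hx.2) (fun x hx ↦ hx.2)
    exact (h4.trans (monotone_extensionProduct_left _ massless_le)).trans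
      (monotone_extensionProduct_right _ h2)
  have h2 : U ≤ extensionProduct U₁ b :=
    (interval_le_extensionProduct (isUpperSet_Ioi (ψ + 1))).trans
      (monotone_extensionProduct_left _ (interval_mono Set.inter_subset_right))
  have h3 : extensionProduct U₁ b ≤ U :=
    (extensionProduct_interval_le fun s hs t ht ↦ (not_lt.1 ht.2).trans_lt hs).trans
      (interval_mono (Set.union_subset (Set.Ioi_subset_Ioi (by linarith)) Set.sdiff_subset))
  have hUU : extensionProduct U U ≤ U := fun X ⟨_, _, _, _, _, hT, hA, hB⟩ ↦
    h.isSlicing.ext_upper (isUpperSet_Ioi ψ) hT hA hB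
  have hdU : extensionProduct d U ≤ extensionProduct U d :=
    h.far_swap (fun _ _ hX ↦ hX.1) (fun _ ↦ le_rfl) fun s hs t ht ↦ by
      have h1 : s ≤ ψ - 1 := not_lt.1 hs
      have h2 : ψ < t := ht
      linarith
  have hcU₁ : extensionProduct c U₁ ≤ extensionProduct U₁ c :=
    h.far_swap (fun _ _ hX ↦ hX.1) (fun _ ↦ le_rfl) fun s hs t ht ↦ by
      have h1 : s ≤ ψ := not_lt.1 hs.2
      have h2 : ψ + 1 < t := ht
      linarith
  -- Phases above `ψ + 1` pass `c` because those extensions split; the remaining heart part passes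
  -- it by `heart_swap`.
  have hcU : extensionProduct c U ≤ extensionProduct U c :=
    calc extensionProduct c U
        ≤ extensionProduct c (extensionProduct U₁ b) := monotone_extensionProduct_right _ h2
      _ = extensionProduct (extensionProduct c U₁) b := by rw [extensionProduct_assoc]
      _ ≤ extensionProduct (extensionProduct U₁ c) b := monotone_extensionProduct_left _ hcU₁
      _ = extensionProduct U₁ (extensionProduct c b) := by rw [extensionProduct_assoc]
      _ ≤ extensionProduct U₁ (extensionProduct b c) :=
          monotone_extensionProduct_right _ (h.heart_swap ψ)
      _ = extensionProduct (extensionProduct U₁ b) c := by rw [extensionProduct_assoc]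
      _ ≤ extensionProduct U c := monotone_extensionProduct_left _ h3
  have hcd : extensionProduct c d ≤ I Set.univ :=
    (extensionProduct_interval_le fun s hs t ht ↦
      (not_lt.1 ht).trans_lt hs.1).trans (interval_mono (Set.subset_univ _))
  calc extensionProduct (I Set.univ) U
      ≤ extensionProduct (extensionProduct U (extensionProduct c d)) U :=
        monotone_extensionProduct_left _ h1
    _ = extensionProduct U (extensionProduct c (extensionProduct d U)) := by
        simp only [extensionProduct_assoc]
    _ ≤ extensionProduct U (extensionProduct c (extensionProduct U d)) :=
        monotone_extensionProduct_right _ (monotone_extensionProduct_right _ hdU)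
    _ = extensionProduct U (extensionProduct (extensionProduct c U) d) := by
        simp only [extensionProduct_assoc]
    _ ≤ extensionProduct U (extensionProduct (extensionProduct U c) d) :=
        monotone_extensionProduct_right _ (monotone_extensionProduct_left _ hcU)
    _ = extensionProduct (extensionProduct U U) (extensionProduct c d) := by
        simp only [extensionProduct_assoc]
    _ ≤ extensionProduct U (I Set.univ) :=
        (monotone_extensionProduct_left _ hUU).trans (monotone_extensionProduct_right _ hcd)

end IsLaxCharge

end Massless

end LaxStability

namespace LaxStability

open ObjectProperty (extensionProduct)
open scoped ZeroObject

/-! ### The slicing and Grothendieck group of the Verdier quotient -/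

section Verdier

variable {C : Type u} [Category.{v} C] [Preadditive C] [HasZeroObject C] [HasShift C ℤ]
  [∀ n : ℤ, (shiftFunctor C n).Additive] [Pretriangulated C] [IsTriangulated C]
  {N : ObjectProperty C} [N.IsTriangulated]

lemma isZero_Q_obj {X : C} (hX : N X) : IsZero (N.trW.Q.obj X) := by
  have : N.trW (0 : (0 : C) ⟶ X) := ⟨X, 𝟙 X, 0, contractible_distinguished₁ X, hX⟩
  have := Localization.inverts N.trW.Q N.trW _ this
  exact (N.trW.Q.map_isZero (isZero_zero C)).of_iso (asIso (N.trW.Q.map (0 : (0 : C) ⟶ X))).symm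

/-- If `X` dies in the quotient, some zero map out of `X` has its cone in `N`. That cone has `X[1]`
as a direct summand, and thickness gives the claim. -/
lemma mem_of_isZero_Q_obj [N.IsStableUnderRetracts] {X : C} (hX : IsZero (N.trW.Q.obj X)) :
    N X := by
  obtain ⟨Y, s, hs, h⟩ := (MorphismProperty.map_eq_iff_postcomp N.trW.Q N.trW (𝟙 X) 0).1
    (hX.eq_of_tgt _ _)
  rw [Category.id_comp, zero_comp] at h
  subst h
  obtain ⟨Z, g, δ, hT, hZ⟩ := hs
  have hδ : Epi δ := (Triangle.mor₁_eq_zero_iff_epi₃ _ hT).1 rfl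
  have : IsSplitEpi δ := isSplitEpi_of_epi δ
  have h1 : N (X⟦(1 : ℤ)⟧) := N.prop_of_retract ⟨section_ δ, δ, IsSplitEpi.id δ⟩ hZ
  exact (N.prop_shift_iff_of_isStableUnderShift X (1 : ℤ)).1 h1

lemma interval_quotientSlicing {P : ℝ → ObjectProperty C} {S : Set ℝ} {X : C}
    (hX : interval P S X) : interval (quotientSlicing N P) S (N.trW.Q.obj X) := by
  refine interval_induction (R := P) (motive := fun S X ↦
    interval (quotientSlicing N P) S (N.trW.Q.obj X))
    (fun _ _ hX ↦ interval_of_isZero (N.trW.Q.map_isZero hX)) ?_ S X hX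
  intro S ψ A X B f g δ hψ hT _ hB _ ih
  exact interval_snoc hψ (N.trW.Q.map_distinguished _ hT) ih ((P ψ).prop_map_obj _ hB)

variable {P : ℝ → ObjectProperty C} {z : C → ℂ}

theorem IsLaxCharge.isSlicing_quotientSlicing (h : IsLaxCharge P z)
    (hN : N = interval (masslessSlicing P z) Set.univ) : IsSlicing (quotientSlicing N P) where
  isoClosed φ := inferInstanceAs ((P φ).map N.trW.Q).IsClosedUnderIsomorphisms
  containsZero φ := by
    have := h.isSlicing.containsZero φ
    obtain ⟨X, hX, hPX⟩ := (P φ).exists_prop_of_containsZero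
    exact ⟨_, N.trW.Q.map_isZero hX, (P φ).prop_map_obj _ hPX⟩
  biprod_mem := by
    rintro φ X Y ⟨A, hA, ⟨e⟩⟩ ⟨B, hB, ⟨e'⟩⟩
    have := preservesBinaryBiproducts_of_preservesBiproducts N.trW.Q
    exact ⟨A ⊞ B, h.isSlicing.biprod_mem φ A B hA hB,
      ⟨N.trW.Q.mapBiprod A B ≪≫ biprod.mapIso e e'⟩⟩
  shift_iff φ X := by
    constructor
    · rintro ⟨A, hA, ⟨e⟩⟩
      refine ⟨A⟦(-1 : ℤ)⟧, (h.isSlicing.shift_iff φ _).1 ?_, ⟨(N.trW.Q.commShiftIso (-1 : ℤ)).app A ≪≫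
        (shiftFunctor _ (-1 : ℤ)).mapIso e ≪≫ (shiftFunctorCompIsoId _ (1 : ℤ) (-1) (by simp)).app X⟩⟩
      have := h.isSlicing.isoClosed (φ + 1)
      exact (P (φ + 1)).prop_of_iso
        ((shiftFunctorCompIsoId C (-1 : ℤ) 1 (by simp)).app A).symm hA
    · rintro ⟨A, hA, ⟨e⟩⟩
      exact ⟨A⟦(1 : ℤ)⟧, (h.isSlicing.shift_iff φ A).2 hA,
        ⟨(N.trW.Q.commShiftIso (1 : ℤ)).app A ≪≫ (shiftFunctor _ (1 : ℤ)).mapIso e⟩⟩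
  hom_eq_zero := by
    rintro φ ψ X Y hlt ⟨A, hA, ⟨e⟩⟩ ⟨B, hB, ⟨e'⟩⟩ f
    suffices ∀ f : N.trW.Q.obj A ⟶ N.trW.Q.obj B, f = 0 by
      rw [← cancel_epi e.hom, ← cancel_mono e'.inv, this ((e.hom ≫ f) ≫ e'.inv), comp_zero,
        zero_comp]
    intro f
    obtain ⟨⟨s, hs, g⟩, hf⟩ := Localization.exists_rightFraction N.trW.Q N.trW f
    have : IsIso (N.trW.Q.map s) := Localization.inverts N.trW.Q N.trW _ hs
    rw [← cancel_epi (N.trW.Q.map s), hf, comp_zero]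
    refine (MorphismProperty.RightFraction.map_s_comp_map
      (MorphismProperty.RightFraction.mk s hs g) N.trW.Q (Localization.inverts _ _)).trans ?_
    -- The source of the fraction is in `N * P(> ψ)`. Rewritten as an object of `P(> ψ) * N`, its
    -- first part admits no nonzero map to `B`, so `g` factors through an object of `N`.
    obtain ⟨M, u, δ, hT, hM⟩ := (N.trW_iff' s).1 hs
    obtain ⟨E, M', v, w, δ', hT', hE, hM'⟩ := h.massless_ext_upper ψ _
      ⟨_, _, _, _, _, hT, hN ▸ hM, interval_of_mem (R := P) (S := Set.Ioi ψ) hlt hA⟩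
    have hvg : v ≫ g = 0 := h.isSlicing.eq_zero_of_interval (S := Set.Ioi ψ) (T := {ψ})
      (fun s hs t ht ↦ by rw [Set.mem_singleton_iff.1 ht]; exact hs) hE (interval_of_mem (Set.mem_singleton ψ) hB) _
    obtain ⟨k, hk⟩ : ∃ k : M' ⟶ B, g = w ≫ k := Triangle.yoneda_exact₂ _ hT' g hvg
    change N.trW.Q.map g = 0
    rw [hk, Functor.map_comp, (isZero_Q_obj (N := N) (hN ▸ hM')).eq_of_tgt (N.trW.Q.map w) 0,
      zero_comp]
  exists_hn X := by
    obtain ⟨H, -⟩ := interval_quotientSlicing (N := N)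
      (h.isSlicing.interval_univ (N.trW.Q.objPreimage X))
    exact ⟨H.ofIso (N.trW.Q.objObjPreimageIso X)⟩

/-- An isomorphism in the quotient is a fraction both of whose legs have cone in `N`; for the
numerator this uses thickness. Each leg preserves `k`. -/
lemma eq_of_Q_obj_iso [N.IsStableUnderRetracts] {G : Type*} [AddCommGroup G] {k : C → G}
    (hk : TriangleAdditive k) (hkN : ∀ X, N X → k X = 0) {X Y : C}
    (e : N.trW.Q.obj X ≅ N.trW.Q.obj Y) : k X = k Y := by
  have hW : ∀ {X Y : C} (s : X ⟶ Y), N.trW s → k X = k Y := by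
    rintro X Y s ⟨Z, g, δ, hT, hZ⟩
    rw [hk.add hT, hkN Z hZ, add_zero]
  obtain ⟨⟨s, hs, g⟩, hf⟩ := Localization.exists_rightFraction N.trW.Q N.trW e.hom
  have : IsIso (N.trW.Q.map s) := Localization.inverts N.trW.Q N.trW _ hs
  have hg : N.trW.Q.map g = N.trW.Q.map s ≫ e.hom := by
    rw [hf]
    exact (MorphismProperty.RightFraction.map_s_comp_map
      (MorphismProperty.RightFraction.mk s hs g) N.trW.Q (Localization.inverts _ _)).symm
  have hg' : IsIso (N.trW.Q.map g) := by rw [hg]; infer_instance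
  obtain ⟨Z, p, δ, hT⟩ := distinguished_cocone_triangle g
  have hZ : IsZero (N.trW.Q.obj Z) :=
    (Triangle.isZero₃_iff_isIso₁ _ (N.trW.Q.map_distinguished _ hT)).2 hg'
  rw [← hW s hs, hW g ⟨Z, p, δ, hT, mem_of_isZero_Q_obj hZ⟩]

/-- The homomorphism on the Grothendieck group of a Verdier quotient induced by an additive
function that vanishes on the kernel. -/
lemma exists_K0_lift [N.IsStableUnderRetracts] {G : Type*} [AddCommGroup G] {k : C → G}
    (hk : TriangleAdditive k) (hkN : ∀ X, N X → k X = 0) :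
    ∃ f : K0 (VerdierQuotient N) →+ G, ∀ X, f (K0.of (N.trW.Q.obj X)) = k X := by
  have hpre : ∀ X, k (N.trW.Q.objPreimage (N.trW.Q.obj X)) = k X := fun X ↦
    eq_of_Q_obj_iso hk hkN (N.trW.Q.objObjPreimageIso _)
  -- Values are read off chosen preimages; `eq_of_Q_obj_iso` makes the choice harmless.
  let g : FreeAbelianGroup (VerdierQuotient N) →+ G :=
    FreeAbelianGroup.lift fun Y ↦ k (N.trW.Q.objPreimage Y)
  have hg : ∀ Y, g (FreeAbelianGroup.of Y) = k (N.trW.Q.objPreimage Y) := fun Y ↦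
    FreeAbelianGroup.lift_apply_of _ _
  refine ⟨QuotientAddGroup.lift _ g ?_, fun X ↦ (hg _).trans (hpre X)⟩
  rw [AddSubgroup.closure_le]
  rintro _ ⟨T, ⟨T', e, hT'⟩, rfl⟩
  have he : ∀ {Y : VerdierQuotient N} {X : C}, (Y ≅ N.trW.Q.obj X) →
      g (FreeAbelianGroup.of Y) = k X := fun {Y X} e ↦
    (hg Y).trans (eq_of_Q_obj_iso hk hkN (N.trW.Q.objObjPreimageIso Y ≪≫ e))
  change g _ = 0
  have h₁ : g (FreeAbelianGroup.of T.obj₁) = k T'.obj₁ := he (Triangle.π₁.mapIso e)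
  have h₂ : g (FreeAbelianGroup.of T.obj₂) = k T'.obj₂ := he (Triangle.π₂.mapIso e)
  have h₃ : g (FreeAbelianGroup.of T.obj₃) = k T'.obj₃ := he (Triangle.π₃.mapIso e)
  rw [map_sub, map_add, h₁, h₂, h₃, sub_eq_zero]
  exact hk _ hT'

end Verdier

end LaxStability

namespace LaxStability

open scoped ZeroObject

lemma IsStrictMono.mono {A : Type*} [Category* A] [HasZeroMorphisms A] {X Y : A} {f : X ⟶ Y}
    (hf : IsStrictMono f) : Mono f := by
  obtain ⟨hf⟩ := hf
  infer_instance

/-! ### Stable subobjects and Jordan–Hölder induction -/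

section JordanHolder

variable {C : Type u} [Category.{v} C] [Preadditive C] [HasZeroObject C] [HasShift C ℤ]
  [∀ n : ℤ, (shiftFunctor C n).Additive] [Pretriangulated C]
  {P : ℝ → ObjectProperty C} {U W : Set ℝ}

lemma IsSlicing.exists_strictSubobject (hP : IsSlicing P) (hW : IsUpperSet W)
    (hUW : ∀ x ∈ U, x + 1 ∈ W) {Q : ObjectProperty C} (hQ : Q = interval P (U \ W))
    {X : Q.FullSubcategory} {Y I : C} (hY : Q Y) (hI : Q I) {f : Y ⟶ X.obj} {g : X.obj ⟶ I}
    {δ : I ⟶ Y⟦(1 : ℤ)⟧} (hT : Triangle.mk f g δ ∈ distTriang C) :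
    ∃ (T : StrictSubobject X) (e : (T.1 : Q.FullSubcategory).obj ≅ Y),
      e.hom ≫ f = T.1.arrow.hom := by
  let F : (⟨Y, hY⟩ : Q.FullSubcategory) ⟶ X := ObjectProperty.homMk f
  have : Mono F := (hP.isStrictMono_of_distTriang hW hUW hQ F hI hT).mono
  let e : ((Subobject.mk F : Subobject X) : Q.FullSubcategory).obj ≅ Y :=
    Q.ι.mapIso (Subobject.underlyingIso F)
  have he : e.hom ≫ f = (Subobject.mk F).arrow.hom :=
    congrArg (fun t ↦ t.hom) (Subobject.underlyingIso_hom_comp_eq_mk F)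
  have hT' := mem_distTriang_of_iso₁ hT e
  rw [he] at hT'
  exact ⟨⟨Subobject.mk F, hP.isStrictMono_of_distTriang hW hUW hQ _ hI hT'⟩, e, he⟩

variable [IsTriangulated C]

lemma IsSlicing.ext_mem (hP : IsSlicing P) {φ : ℝ} {T : Triangle C} (hT : T ∈ distTriang C)
    (h₁ : P φ T.obj₁) (h₃ : P φ T.obj₃) : P φ T.obj₂ := by
  rw [← hP.interval_singleton] at *
  exact hP.ext_sdiff (isUpperSet_Ici φ) (isUpperSet_Ioi φ) hT h₁ h₃

omit [IsTriangulated C] in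
lemma Ioo_eq_sdiff {ε φ : ℝ} : Set.Ioo (φ - ε) (φ + ε) =
    Set.Ioi (φ - ε) \ Set.Ici (φ + ε) := by
  ext x
  simp

omit [IsTriangulated C] in
-- The chain conditions hold in `P(φ - ε, φ + ε)` and not by definition in `P φ`. Triangles with
-- vertices in `P φ` give strict subobjects in the larger category, so chains can be tested there;
-- `ε < 1/2` keeps the interval shorter than one.
lemma IsSlicing.exists_lengthCategory (hP : IsSlicing P) (hf : IsLocallyFinite P) (φ : ℝ) :
    ∃ Q : ObjectProperty C, IsLengthCategory Q.FullSubcategory ∧ P φ ≤ Q ∧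
      ∀ (X : Q.FullSubcategory) (Y I : C) (f : Y ⟶ X.obj) (g : X.obj ⟶ I) (δ : I ⟶ Y⟦(1 : ℤ)⟧),
        P φ Y → P φ I → Triangle.mk f g δ ∈ distTriang C →
        ∃ (T : StrictSubobject X) (e : (T.1 : Q.FullSubcategory).obj ≅ Y),
          e.hom ≫ f = T.1.arrow.hom := by
  obtain ⟨ε, hε, hε', hlen⟩ := hf
  have hUW : ∀ x ∈ Set.Ioi (φ - ε), x + 1 ∈ Set.Ici (φ + ε) := fun x hx ↦ by
    rw [Set.mem_Ioi] at hx
    rw [Set.mem_Ici]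
    linarith
  have hle : P φ ≤ interval P (Set.Ioo (φ - ε) (φ + ε)) := fun Y hY ↦
    interval_of_mem (Set.mem_Ioo.2 ⟨by linarith, by linarith⟩) hY
  exact ⟨_, hlen φ, hle, fun X Y I f g δ hY hI hT ↦ hP.exists_strictSubobject
    (isUpperSet_Ici (φ + ε)) hUW (by rw [Ioo_eq_sdiff]) (hle _ hY) (hle _ hI) hT⟩

/-- A nonzero semistable object for a locally finite slicing has a stable subobject. -/
lemma IsSlicing.exists_stable_sub (hP : IsSlicing P) (hf : IsLocallyFinite P) {φ : ℝ} {X : C}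
    (hX : P φ X) (h0 : ¬ IsZero X) :
    ∃ (Y I : C) (f : Y ⟶ X) (g : X ⟶ I) (δ : I ⟶ Y⟦(1 : ℤ)⟧),
      Triangle.mk f g δ ∈ distTriang C ∧ IsStable P φ Y ∧ P φ I := by
  have := hP.isoClosed
  have := hP.containsZero φ
  obtain ⟨Q, hlen, hle, hsub⟩ := hP.exists_lengthCategory hf φ
  let X' : Q.FullSubcategory := ⟨X, hle _ hX⟩
  let good : Set (StrictSubobject X') := {T | ∃ (I : C) (g : X ⟶ I)
    (δ : I ⟶ (T.1 : Q.FullSubcategory).obj⟦(1 : ℤ)⟧),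
    ¬ IsZero (T.1 : Q.FullSubcategory).obj ∧ P φ (T.1 : Q.FullSubcategory).obj ∧ P φ I ∧
      Triangle.mk T.1.arrow.hom g δ ∈ distTriang C}
  have hgood : ∀ {Y I : C} {f : Y ⟶ X} {g : X ⟶ I} {δ : I ⟶ Y⟦(1 : ℤ)⟧}, ¬ IsZero Y → P φ Y →
      P φ I → Triangle.mk f g δ ∈ distTriang C → ∃ T ∈ good,
        ∃ e : (T.1 : Q.FullSubcategory).obj ≅ Y, e.hom ≫ f = T.1.arrow.hom := by
    intro Y I f g δ hY0 hY hI hT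
    obtain ⟨T, e, he⟩ := hsub X' Y I f g δ hY hI hT
    refine ⟨T, ⟨I, g, δ ≫ e.inv⟦(1 : ℤ)⟧', fun h ↦ hY0 (h.of_iso e.symm),
      (P φ).prop_of_iso e.symm hY, hI, ?_⟩, e, he⟩
    have := mem_distTriang_of_iso₁ hT e
    rwa [he] at this
  have hne : good.Nonempty := by
    obtain ⟨T, hT, -⟩ := hgood h0 hX ((P φ).prop_of_isZero (isZero_zero C))
      (contractible_distinguished X)
    exact ⟨T, hT⟩
  -- A minimal nonzero subobject with semistable quotient of phase `φ` is stable: by the octahedron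
  -- a strict subobject of it again has its quotient in `P φ`, so it is zero or everything.
  obtain ⟨T, ⟨I, g, δ, hT0, hTP, hI, hT⟩, hmin⟩ := (hlen X').1.wf.has_min good hne
  refine ⟨_, I, T.1.arrow.hom, g, δ, hT, ⟨hTP, ?_, ?_⟩, hI⟩
  · exact fun h ↦ hT0 (((P φ).ι).map_isZero h)
  · intro Y f hfs
    refine or_iff_not_imp_left.2 fun hY ↦ ?_
    have hY0 : ¬ IsZero Y.obj := fun h ↦ hY ((IsZero.iff_id_eq_zero _).2 (by
      ext
      exact h.eq_of_src _ _))
    obtain ⟨J, g', δ', hJ, hT'⟩ := hP.exists_cone_of_isStrictMono (isUpperSet_Ici φ)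
      (isUpperSet_Ioi φ) (Set.Ioi_subset_Ici le_rfl)
      (fun x hx ↦ by
        have : φ ≤ x := hx
        change φ < x + 1
        linarith) hP.interval_singleton.symm hfs
    obtain ⟨L, p, q, hL⟩ := distinguished_cocone_triangle (f.hom ≫ T.1.arrow.hom)
    have o := Triangulated.someOctahedron rfl hT' hT hL
    have hLP : P φ L := hP.ext_mem o.mem hJ hI
    obtain ⟨T', hT'g, e, he⟩ := hgood hY0 Y.property hLP hL
    have hTT' : T'.1 ≤ T.1 := Subobject.le_of_comm
      (ObjectProperty.homMk (e.hom ≫ f.hom)) (by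
        ext
        exact (Category.assoc _ _ _).trans he)
    have hTT : T.1 ≤ T'.1 := by
      by_contra hcon
      exact hmin T' hT'g (lt_of_le_not_ge hTT' hcon)
    have hs : ((Subobject.ofLE _ _ hTT).hom ≫ e.hom) ≫ f.hom = 𝟙 _ := by
      have h1 : (Subobject.ofLE _ _ hTT).hom ≫ T'.1.arrow.hom = T.1.arrow.hom :=
        congrArg (fun t ↦ t.hom) (Subobject.ofLE_arrow hTT)
      have h2 : (ObjectProperty.homMk (((Subobject.ofLE _ _ hTT).hom ≫ e.hom) ≫ f.hom) :
          (T.1 : Q.FullSubcategory) ⟶ (T.1 : Q.FullSubcategory)) = 𝟙 _ := by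
        rw [← cancel_mono T.1.arrow]
        ext
        change (((Subobject.ofLE _ _ hTT).hom ≫ e.hom) ≫ f.hom) ≫ T.1.arrow.hom =
          𝟙 _ ≫ T.1.arrow.hom
        rw [Category.assoc, Category.assoc, he, h1, Category.id_comp]
      exact congrArg (fun t ↦ t.hom) h2
    have := hfs.mono
    have hsplit : (ObjectProperty.homMk ((Subobject.ofLE _ _ hTT).hom ≫ e.hom) : _ ⟶ Y) ≫ f =
        𝟙 _ := by
      ext
      exact hs
    exact ⟨_, by rw [← cancel_mono f, Category.assoc, hsplit, Category.comp_id,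
      Category.id_comp], hsplit⟩

/-- Induction on the Jordan–Hölder filtration of a semistable object. -/
theorem IsSlicing.induction_of_stable (hP : IsSlicing P) (hf : IsLocallyFinite P) {φ : ℝ}
    {q : C → Prop} (hzero : ∀ X, IsZero X → q X) (hstable : ∀ X, IsStable P φ X → q X)
    (hext : ∀ T ∈ distTriang C, P φ T.obj₁ → P φ T.obj₃ → q T.obj₁ → q T.obj₃ → q T.obj₂)
    {X : C} (hX : P φ X) : q X := by
  have := hP.isoClosed
  have := hP.containsZero φ
  have hPzero : ∀ {Y}, IsZero Y → P φ Y := fun hY ↦ (P φ).prop_of_isZero hY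
  have hiso : ∀ {Y Z : C}, (Y ≅ Z) → P φ Y → q Y → q Z := fun e hY h ↦
    hext _ (mem_distTriang_of_iso₁ (contractible_distinguished _) e) hY
      (hPzero (isZero_zero C)) h (hzero _ (isZero_zero C))
  obtain ⟨Q, hlen, hle, hsub⟩ := hP.exists_lengthCategory hf φ
  let X' : Q.FullSubcategory := ⟨X, hle _ hX⟩
  let good : Set (StrictSubobject X') := {T | ∃ (I : C) (g : X ⟶ I)
    (δ : I ⟶ (T.1 : Q.FullSubcategory).obj⟦(1 : ℤ)⟧),
    q (T.1 : Q.FullSubcategory).obj ∧ P φ (T.1 : Q.FullSubcategory).obj ∧ P φ I ∧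
      Triangle.mk T.1.arrow.hom g δ ∈ distTriang C}
  have hgood : ∀ {Y I : C} {f : Y ⟶ X} {g : X ⟶ I} {δ : I ⟶ Y⟦(1 : ℤ)⟧}, q Y → P φ Y →
      P φ I → Triangle.mk f g δ ∈ distTriang C → ∃ T ∈ good,
        ∃ e : (T.1 : Q.FullSubcategory).obj ≅ Y, e.hom ≫ f = T.1.arrow.hom := by
    intro Y I f g δ hY0 hY hI hT
    obtain ⟨T, e, he⟩ := hsub X' Y I f g δ hY hI hT
    refine ⟨T, ⟨I, g, δ ≫ e.inv⟦(1 : ℤ)⟧', hiso e.symm hY hY0,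
      (P φ).prop_of_iso e.symm hY, hI, ?_⟩, e, he⟩
    have := mem_distTriang_of_iso₁ hT e
    rwa [he] at this
  have hne : good.Nonempty := by
    obtain ⟨T, hT, -⟩ := hgood (hzero _ (isZero_zero C)) (hPzero (isZero_zero C)) hX
      (contractible_distinguished₁ X)
    exact ⟨T, hT⟩
  -- Choose a maximal subobject satisfying `q` with quotient in `P φ`. If the quotient `I` were
  -- nonzero, the preimage `Y` of a stable subobject of `I` would satisfy `q` too.
  obtain ⟨T, ⟨I, g, δ, hTq, hTP, hI, hT⟩, hmax⟩ := (hlen X').2.wf.has_min good hne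
  by_cases hI0 : IsZero I
  · have : IsIso T.1.arrow.hom := (Triangle.isZero₃_iff_isIso₁ _ hT).1 hI0
    exact hiso (asIso T.1.arrow.hom) hTP hTq
  obtain ⟨s, J, i, p, δ', hs, hst, hJ⟩ := hP.exists_stable_sub hf hI hI0
  obtain ⟨Y, a, b, hY⟩ := distinguished_cocone_triangle₁ (g ≫ p)
  have o := Triangulated.someOctahedron' rfl hT hs hY
  have hYP : P φ Y := hP.ext_mem o.mem hTP hst.choose
  have hYq : q Y := hext _ o.mem hTP hst.choose hTq (hstable _ hst)
  obtain ⟨T', hT'g, e, he⟩ := hgood hYq hYP hJ hY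
  have hTT' : T.1 ≤ T'.1 := Subobject.le_of_comm
    (ObjectProperty.homMk (o.m₁ ≫ e.inv)) (by
      ext
      change (o.m₁ ≫ e.inv) ≫ T'.1.arrow.hom = T.1.arrow.hom
      rw [← he, Category.assoc, e.inv_hom_id_assoc, o.comm₁])
  have hTT : T'.1 ≤ T.1 := by
    by_contra hcon
    exact hmax T' hT'g (lt_of_le_not_ge hTT' hcon)
  -- By maximality `Y` is contained in `T`, so `Y ⟶ X ⟶ I` vanishes. Then `Y ⟶ s` vanishes, which
  -- forces the stable object `s` to be zero.
  have hag : a ≫ g = 0 := by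
    have h1 : (Subobject.ofLE _ _ hTT).hom ≫ T.1.arrow.hom = T'.1.arrow.hom :=
      congrArg (fun t ↦ t.hom) (Subobject.ofLE_arrow hTT)
    have h2 : T.1.arrow.hom ≫ g = 0 := comp_distTriang_mor_zero₁₂ _ hT
    rw [← cancel_epi e.hom, reassoc_of% he, ← h1, Category.assoc, h2, comp_zero, comp_zero]
  have hm : o.m₃ ≫ i = 0 := by rw [o.comm₄, hag]
  have hs0 : o.m₃ = 0 := by
    refine truncation_map_unique₁ hs ?_ (by rw [hm, zero_comp])
    exact hP.eq_zero_of_interval_shift (S := {φ}) (T := {φ}) (by simp)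
      (interval_of_mem (Set.mem_singleton φ) hYP) (interval_of_mem (Set.mem_singleton φ) hJ)
  exfalso
  obtain ⟨hsP, hsz, -⟩ := hst
  refine hsz ((IsZero.iff_id_eq_zero _).2 ?_)
  ext
  obtain ⟨k, hk⟩ : ∃ k : (T.1 : Q.FullSubcategory).obj⟦(1 : ℤ)⟧ ⟶ s, 𝟙 s = (i ≫ δ) ≫ k :=
    Triangle.yoneda_exact₃ _ o.mem (𝟙 s) (by
      change o.m₃ ≫ _ = 0
      rw [hs0, zero_comp])
  have hk0 : k = 0 := hP.eq_zero_of_interval_shift (S := {φ}) (T := {φ}) (by simp)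
    (interval_of_mem (Set.mem_singleton φ) hTP) (interval_of_mem (Set.mem_singleton φ) hsP) k
  rw [hk0, comp_zero] at hk
  exact hk

end JordanHolder

end LaxStability

namespace LaxStability

open scoped ZeroObject

lemma IsStrictMono.of_comp {A : Type*} [Category* A] [HasZeroMorphisms A] {X Y Z : A} {f : X ⟶ Y}
    {g : Y ⟶ Z} [Mono g] (h : IsStrictMono (f ≫ g)) : IsStrictMono f := by
  have hm : Mono (f ≫ g) := h.mono
  have : Mono f := mono_of_mono f g
  obtain ⟨hn⟩ := h
  have hlift : ∀ {W : A} (k : W ⟶ Y), k ≫ g ≫ hn.g = 0 → ∃ l : W ⟶ X, l ≫ f = k := by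
    intro W k hk
    obtain ⟨l, hl⟩ := NormalMono.lift' (f ≫ g) (k ≫ g) (by rw [Category.assoc, hk])
    exact ⟨l, by rw [← cancel_mono g, Category.assoc, hl]⟩
  exact ⟨{
    Z := hn.Z
    g := g ≫ hn.g
    w := by rw [← Category.assoc, hn.w]
    isLimit := KernelFork.IsLimit.ofι f _ (fun k hk ↦ (hlift k hk).choose)
      (fun k hk ↦ (hlift k hk).choose_spec)
      (fun k hk m hm ↦ by rw [← cancel_mono f, hm, (hlift k hk).choose_spec]) }⟩

/-! ### Local finiteness from the support property -/

section Support

variable {C : Type u} [Category.{v} C] [Preadditive C] [HasZeroObject C] [HasShift C ℤ]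
  [∀ n : ℤ, (shiftFunctor C n).Additive] [Pretriangulated C]
  {P : ℝ → ObjectProperty C} {Λ : Type*} [AddCommGroup Λ]

lemma ray_re_bounds {m φ ψ : ℝ} (hm : 0 < m) (hψ : ψ ∈ Set.Ioo (φ - 1 / 4) (φ + 1 / 4)) :
    Real.cos (Real.pi / 4) * m ≤
      (Complex.exp (-(Complex.I * Real.pi * φ)) *
        (m * Complex.exp (Complex.I * Real.pi * ψ))).re := by
  rw [rotate_ray, mul_comm m]
  refine mul_le_mul_of_nonneg_right ?_ hm.le
  rw [← Real.cos_abs (Real.pi * (ψ - φ))]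
  have h1 : |ψ - φ| ≤ 1 / 4 := abs_le.2 ⟨by linarith [hψ.1], by linarith [hψ.2]⟩
  refine Real.cos_le_cos_of_nonneg_of_le_pi (abs_nonneg _) (by linarith [Real.pi_pos]) ?_
  rw [abs_mul, abs_of_pos Real.pi_pos]
  nlinarith [Real.pi_pos]

/-- A slicing with a charge that satisfies the support property is locally finite. -/
theorem IsSlicing.isLocallyFinite_of_support [IsTriangulated C] (hP : IsSlicing P) {k : C → Λ}
    (hk : TriangleAdditive k) (Z : Λ →+ ℂ)
    (charge : ∀ (φ : ℝ) (X : C), P φ X → ¬ IsZero X →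
      ∃ m : ℝ, 0 < m ∧ Z (k X) = m * Complex.exp (Complex.I * Real.pi * φ))
    {nrm : Λ → ℝ} (nrm_zero : nrm 0 ≤ 0) (nrm_add : ∀ a b, nrm (a + b) ≤ nrm a + nrm b)
    (finite : ∀ r, {l | nrm l ≤ r}.Finite) {K : ℝ} (hK : 0 < K)
    (support : ∀ (φ : ℝ) (X : C), P φ X → 1 / K * nrm (k X) ≤ ‖Z (k X)‖) :
    IsLocallyFinite P := by
  -- With `ε = 1/4` the rotated charges make an angle of at most `π / 4` with the positive real
  -- axis, so their real part `ℓ` is at least `cos (π / 4)` times their absolute value.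
  refine ⟨1 / 4, by norm_num, by norm_num, fun φ ↦ ?_⟩
  set ℓ : Λ → ℝ := fun l ↦ (Complex.exp (-(Complex.I * Real.pi * φ)) * Z l).re with hℓ
  have hℓ_add : ∀ a b, ℓ (a + b) = ℓ a + ℓ b := fun a b ↦ by
    simp only [hℓ, map_add, mul_add, Complex.add_re]
  have hℓ_zero : ℓ 0 = 0 := by simp [hℓ]
  set c := Real.cos (Real.pi / 4) with hc
  have hc0 : 0 < c := Real.cos_pos_of_mem_Ioo ⟨by linarith [Real.pi_pos], by linarith [Real.pi_pos]⟩
  -- The support bound holds for semistable objects only. The linear form `ℓ`, unlike the absolute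
  -- value of the charge, is additive and carries the bound to the whole interval.
  have key : ∀ S X, interval P S X → S ⊆ Set.Ioo (φ - 1 / 4) (φ + 1 / 4) →
      c * nrm (k X) ≤ K * ℓ (k X) ∧ 0 ≤ ℓ (k X) ∧ (¬ IsZero X → 0 < ℓ (k X)) := by
    refine interval_induction ?_ ?_
    · intro S X hX _
      rw [hk.of_isZero hX, hℓ_zero, mul_zero]
      exact ⟨mul_nonpos_of_nonneg_of_nonpos hc0.le nrm_zero, le_rfl, fun h ↦ absurd hX h⟩
    · intro S ψ A X B f g δ hψ hT _ hB hB0 ih hS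
      obtain ⟨h1, h2, -⟩ := ih fun x hx ↦ hS hx.1
      obtain ⟨m, hm, hZ⟩ := charge ψ B hB hB0
      have hbd : c * m ≤ ℓ (k B) := by
        simp only [hℓ, hZ]
        exact ray_re_bounds hm (hS hψ)
      have hnorm : ‖Z (k B)‖ = m := by
        have : Complex.I * Real.pi * ψ = ((Real.pi * ψ : ℝ) : ℂ) * Complex.I := by
          push_cast; ring
        rw [hZ, this, norm_mul, Complex.norm_exp_ofReal_mul_I, Complex.norm_real, mul_one,
          Real.norm_of_nonneg hm.le]
      have hs := support ψ B hB
      rw [hnorm, one_div, inv_mul_le_iff₀ hK] at hs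
      have hpos : 0 < ℓ (k B) := lt_of_lt_of_le (mul_pos hc0 hm) hbd
      rw [hk.add hT, hℓ_add]
      refine ⟨?_, by linarith, fun _ ↦ by linarith⟩
      calc c * nrm (k A + k B) ≤ c * (nrm (k A) + nrm (k B)) := by gcongr; exact nrm_add _ _
        _ = c * nrm (k A) + c * nrm (k B) := mul_add _ _ _
        _ ≤ K * ℓ (k A) + c * (K * m) := by gcongr
        _ = K * ℓ (k A) + K * (c * m) := by ring
        _ ≤ K * ℓ (k A) + K * ℓ (k B) := by gcongr
        _ = K * (ℓ (k A) + ℓ (k B)) := by ring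
  have hUW : ∀ x ∈ Set.Ioi (φ - 1 / 4), x + 1 ∈ Set.Ici (φ + 1 / 4) := fun x hx ↦ by
    rw [Set.mem_Ioi] at hx
    rw [Set.mem_Ici]
    linarith
  have hWU : Set.Ici (φ + 1 / 4) ⊆ Set.Ioi (φ - 1 / 4) := fun x hx ↦ by
    rw [Set.mem_Ici] at hx
    rw [Set.mem_Ioi]
    linarith
  have hcone := fun {Y E : (interval P (Set.Ioo (φ - 1 / 4) (φ + 1 / 4))).FullSubcategory}
    {f : Y ⟶ E} (hf : IsStrictMono f) ↦ hP.exists_cone_of_isStrictMono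
      (isUpperSet_Ioi (φ - 1 / 4)) (isUpperSet_Ici (φ + 1 / 4)) hWU hUW (by rw [Ioo_eq_sdiff]) hf
  intro X
  -- A strict subobject has `ℓ` at most that of `X`, so its class has bounded norm and `ℓ` takes
  -- finitely many values. A proper inclusion has a nonzero cone and strictly increases `ℓ`, which
  -- bounds chains in both directions.
  set F : Set ℝ := ℓ '' {l | nrm l ≤ K * ℓ (k X.obj) / c} with hF
  have hFfin : F.Finite := (finite _).image _
  have hmem : ∀ T : StrictSubobject X, ℓ (k (Subobject.underlying.obj T.1).obj) ∈ F := by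
    intro T
    obtain ⟨I, g, δ, hI, hT⟩ := hcone T.2
    have hsum := hk.add hT
    refine ⟨_, ?_, rfl⟩
    have h1 := (key _ _ (Subobject.underlying.obj T.1).property subset_rfl).1
    have h2 := (key _ _ hI subset_rfl).2.1
    rw [Set.mem_ofPred_eq, le_div_iff₀ hc0, mul_comm]
    refine h1.trans (mul_le_mul_of_nonneg_left ?_ hK.le)
    rw [hsum, hℓ_add]
    linarith
  let r : StrictSubobject X → F := fun T ↦ ⟨_, hmem T⟩
  have hr : StrictMono r := by
    intro S T hST
    have hle : S.1 ≤ T.1 := hST.le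
    have hfac := Subobject.ofLE_arrow hle
    obtain ⟨I, g, δ, hI, hT⟩ := hcone (IsStrictMono.of_comp (f := Subobject.ofLE _ _ hle)
      (g := T.1.arrow) (by rw [hfac]; exact S.2))
    have hI0 : ¬ IsZero I := by
      intro hI0
      have : IsIso (Subobject.ofLE _ _ hle).hom := (Triangle.isZero₃_iff_isIso₁ _ hT).1 hI0
      refine hST.not_ge (Subobject.le_of_comm
        (ObjectProperty.homMk (inv (Subobject.ofLE _ _ hle).hom)) ?_)
      ext
      change inv (Subobject.ofLE _ _ hle).hom ≫ S.1.arrow.hom = T.1.arrow.hom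
      rw [IsIso.inv_comp_eq]
      exact (congrArg (fun t ↦ t.hom) hfac).symm
    have hpos := (key _ _ hI subset_rfl).2.2 hI0
    have hsum := hk.add hT
    change ℓ (k (Subobject.underlying.obj S.1).obj) < ℓ (k (Subobject.underlying.obj T.1).obj)
    rw [hsum, hℓ_add]
    linarith
  have : Finite F := hFfin
  exact ⟨hr.wellFoundedLT, hr.wellFoundedGT⟩

end Support

end LaxStability

namespace LaxStability

/-! ### Quotient norms and lattices -/

section CoreNorm

variable {E : Type*} [AddCommGroup E] [Module ℝ E] (ip : InnerProductSpace.Core ℝ E)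

lemma sqrt_inner_add_le (x y : E) :
    √(ip.inner (x + y) (x + y)) ≤ √(ip.inner x x) + √(ip.inner y y) := by
  let := ip.toNormedAddCommGroup
  exact norm_add_le x y

lemma exists_abs_le_sqrt_inner [FiniteDimensional ℝ E] (f : E →ₗ[ℝ] ℝ) :
    ∃ c, 0 ≤ c ∧ ∀ x, |f x| ≤ c * √(ip.inner x x) := by
  let := ip.toNormedAddCommGroup
  let : InnerProductSpace ℝ E := .ofCore ip.toCore
  exact ⟨‖LinearMap.toContinuousLinearMap f‖, ContinuousLinearMap.opNorm_nonneg _,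
    fun x ↦ (LinearMap.toContinuousLinearMap f).le_opNorm x⟩

end CoreNorm

section QuotientNorm

variable {Λ : Type w} [AddCommGroup Λ] (ip : InnerProductSpace.Core ℝ (ℝ ⊗[ℤ] Λ))
  (M : AddSubgroup Λ)

lemma quotientNorm_le {l : Λ} {a : ℝ ⊗[ℤ] Λ}
    (ha : a ∈ Submodule.span ℝ {x : ℝ ⊗[ℤ] Λ | ∃ m ∈ M, x = (1 : ℝ) ⊗ₜ[ℤ] m}) :
    quotientNorm ip M (QuotientAddGroup.mk l) ≤
      √(ip.inner ((1 : ℝ) ⊗ₜ[ℤ] l + a) ((1 : ℝ) ⊗ₜ[ℤ] l + a)) :=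
  csInf_le ⟨0, by rintro _ ⟨_, _, _, _, rfl⟩; exact Real.sqrt_nonneg _⟩ ⟨l, rfl, a, ha, rfl⟩

lemma quotientNorm_mk_le (l : Λ) :
    quotientNorm ip M (QuotientAddGroup.mk l) ≤ latticeNorm ip l := by
  have := quotientNorm_le ip M (l := l) (Submodule.zero_mem _)
  rwa [add_zero] at this

lemma quotientNorm_zero : quotientNorm ip M 0 ≤ 0 := by
  refine (quotientNorm_mk_le ip M 0).trans ?_
  let := ip.toNormedAddCommGroup
  rw [latticeNorm, TensorProduct.tmul_zero]
  exact (norm_zero (E := ℝ ⊗[ℤ] Λ)).le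

lemma exists_lt_of_quotientNorm_lt {q : Λ ⧸ M} {r : ℝ} (h : quotientNorm ip M q < r) :
    ∃ l : Λ, (QuotientAddGroup.mk l : Λ ⧸ M) = q ∧
      ∃ a ∈ Submodule.span ℝ {x : ℝ ⊗[ℤ] Λ | ∃ m ∈ M, x = (1 : ℝ) ⊗ₜ[ℤ] m},
        √(ip.inner ((1 : ℝ) ⊗ₜ[ℤ] l + a) ((1 : ℝ) ⊗ₜ[ℤ] l + a)) < r := by
  obtain ⟨l, rfl⟩ := QuotientAddGroup.mk_surjective q
  unfold quotientNorm at h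
  obtain ⟨_, ⟨l', h1, a, ha, rfl⟩, h2⟩ := exists_lt_of_csInf_lt (by
    exact ⟨_, l, rfl, 0, Submodule.zero_mem _, rfl⟩) h
  exact ⟨l', h1, a, ha, h2⟩

lemma quotientNorm_add_le (p q : Λ ⧸ M) :
    quotientNorm ip M (p + q) ≤ quotientNorm ip M p + quotientNorm ip M q := by
  refine le_of_forall_pos_le_add fun ε hε ↦ ?_
  obtain ⟨l, rfl, a, ha, hl⟩ := exists_lt_of_quotientNorm_lt ip M
    (lt_add_of_pos_right (quotientNorm ip M p) (half_pos hε))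
  obtain ⟨m, rfl, b, hb, hm⟩ := exists_lt_of_quotientNorm_lt ip M
    (lt_add_of_pos_right (quotientNorm ip M q) (half_pos hε))
  have h := quotientNorm_le ip M (l := l + m) (Submodule.add_mem _ ha hb)
  rw [TensorProduct.tmul_add, add_add_add_comm] at h
  have h' := sqrt_inner_add_le ip ((1 : ℝ) ⊗ₜ[ℤ] l + a) ((1 : ℝ) ⊗ₜ[ℤ] m + b)
  rw [QuotientAddGroup.mk_add] at h
  linarith

/-- A homomorphism `Λ ⧸ M → ℤ` is bounded with respect to the quotient norm. -/
lemma exists_abs_le_quotientNorm [Module.Finite ℤ Λ] (f : Λ ⧸ M →+ ℤ) :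
    ∃ c : ℝ, 0 ≤ c ∧ ∀ q, |(f q : ℝ)| ≤ c * quotientNorm ip M q := by
  let g : Λ →ₗ[ℤ] ℝ :=
    (((Int.castAddHom ℝ).comp f).comp (QuotientAddGroup.mk' M)).toIntLinearMap
  let F : ℝ ⊗[ℤ] Λ →ₗ[ℝ] ℝ := LinearMap.liftBaseChange ℝ g
  have hF : ∀ l : Λ, F ((1 : ℝ) ⊗ₜ[ℤ] l) = f (QuotientAddGroup.mk l) := fun l ↦ by
    rw [LinearMap.liftBaseChange_tmul, one_smul]
    rfl
  -- The functional does not see the correction `a`, so a bound on `l + a` bounds its value at the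
  -- class of `l`.
  have hF0 : ∀ a ∈ Submodule.span ℝ {x : ℝ ⊗[ℤ] Λ | ∃ m ∈ M, x = (1 : ℝ) ⊗ₜ[ℤ] m},
      F a = 0 := by
    intro a ha
    refine (Submodule.span_le (p := LinearMap.ker F)).2 ?_ ha
    rintro _ ⟨m, hm, rfl⟩
    change F _ = 0
    rw [hF, (QuotientAddGroup.eq_zero_iff m).2 hm, map_zero, Int.cast_zero]
  obtain ⟨c, hc, hb⟩ := exists_abs_le_sqrt_inner ip F
  refine ⟨c, hc, fun q ↦ le_of_forall_pos_le_add fun ε hε ↦ ?_⟩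
  -- The denominator is `c + 1` because `c` may be zero.
  obtain ⟨l, rfl, a, ha, hl⟩ := exists_lt_of_quotientNorm_lt ip M
    (lt_add_of_pos_right (quotientNorm ip M q) (show 0 < ε / (c + 1) by positivity))
  have h := hb ((1 : ℝ) ⊗ₜ[ℤ] l + a)
  rw [map_add, hF, hF0 a ha, add_zero] at h
  refine h.trans ((mul_le_mul_of_nonneg_left hl.le hc).trans ?_)
  rw [mul_add]
  gcongr
  rw [mul_div_assoc', div_le_iff₀ (by positivity)]
  nlinarith

/-- On a ball the coordinates in a basis of `Λ ⧸ M` are integers bounded by multiples of the norm,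
leaving finitely many coordinate vectors. -/
lemma finite_quotientNorm_le [Module.Finite ℤ Λ] [Module.Free ℤ (Λ ⧸ M)] (r : ℝ) :
    {q | quotientNorm ip M q ≤ r}.Finite := by
  have : Module.Finite ℤ (Λ ⧸ M) := Module.Finite.of_surjective
    (QuotientAddGroup.mk' M).toIntLinearMap (QuotientAddGroup.mk'_surjective M)
  let b := Module.Free.chooseBasis ℤ (Λ ⧸ M)
  choose c hc hb using fun i ↦ exists_abs_le_quotientNorm ip M (b.coord i).toAddMonoidHom
  refine Set.Finite.of_finite_image (f := b.equivFun) ?_ b.equivFun.injective.injOn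
  refine (Set.finite_Icc (fun i ↦ -⌊c i * r⌋) (fun i ↦ ⌊c i * r⌋)).subset ?_
  rintro _ ⟨q, hq, rfl⟩
  have key : ∀ i, |b.equivFun q i| ≤ ⌊c i * r⌋ := fun i ↦ by
    rw [Int.le_floor, Int.cast_abs]
    exact (hb i q).trans (mul_le_mul_of_nonneg_left hq (hc i))
  exact ⟨fun i ↦ (abs_le.1 (key i)).1, fun i ↦ (abs_le.1 (key i)).2⟩

end QuotientNorm

section SaturatedSublattice

variable {C : Type u} [Category.{v} C] [Preadditive C] [HasZeroObject C] [HasShift C ℤ]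
  [∀ n : ℤ, (shiftFunctor C n).Additive] [Pretriangulated C]
  {Λ : Type w} [AddCommGroup Λ] (cl : K0 C →+ Λ) (N : ObjectProperty C)

lemma mem_saturatedSublattice {X : C} (hX : N X) : cl (K0.of X) ∈ saturatedSublattice cl N :=
  AddSubgroup.mem_sInf.2 fun _ hM ↦ hM.1 X hX

lemma saturatedSublattice_le {M : AddSubgroup Λ} (h : ∀ X : C, N X → cl (K0.of X) ∈ M)
    (hM : ∀ (k : ℤ) (l : Λ), k ≠ 0 → k • l ∈ M → l ∈ M) : saturatedSublattice cl N ≤ M :=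
  sInf_le ⟨h, hM⟩

lemma mem_saturatedSublattice_of_zsmul {k : ℤ} {l : Λ} (hk : k ≠ 0)
    (h : k • l ∈ saturatedSublattice cl N) : l ∈ saturatedSublattice cl N :=
  AddSubgroup.mem_sInf.2 fun M hM ↦ hM.2 k l hk (AddSubgroup.mem_sInf.1 h M hM)

lemma free_quotient_saturatedSublattice [Module.Finite ℤ Λ] :
    Module.Free ℤ (Λ ⧸ saturatedSublattice cl N) := by
  have : Module.Finite ℤ (Λ ⧸ saturatedSublattice cl N) := Module.Finite.of_surjective
    (QuotientAddGroup.mk' (saturatedSublattice cl N)).toIntLinearMap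
    (QuotientAddGroup.mk'_surjective _)
  have : Module.IsTorsionFree ℤ (Λ ⧸ saturatedSublattice cl N) := by
    rw [Module.isTorsionFree_iff_smul_eq_zero]
    intro k q
    obtain ⟨l, rfl⟩ := QuotientAddGroup.mk_surjective q
    intro h
    refine or_iff_not_imp_left.2 fun hk ↦ ?_
    rw [← QuotientAddGroup.mk_zsmul, QuotientAddGroup.eq_zero_iff] at h
    exact (QuotientAddGroup.eq_zero_iff l).2 (mem_saturatedSublattice_of_zsmul cl N hk h)
  infer_instance

end SaturatedSublattice

end LaxStability

namespace LaxStability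

open scoped ZeroObject

/-! ### Mass, charge and the support property on the quotient -/

section Charge

variable {C : Type u} [Category.{v} C] [Preadditive C] [HasZeroObject C] [HasShift C ℤ]
  [∀ n : ℤ, (shiftFunctor C n).Additive] [Pretriangulated C]
  {Λ : Type w} [AddCommGroup Λ] {cl : K0 C →+ Λ} {P : ℝ → ObjectProperty C} {Z : Λ →+ ℂ}

lemma IsLaxPreStabilityCondition.isLaxCharge (h : IsLaxPreStabilityCondition cl P Z) :
    IsLaxCharge P (fun X ↦ Z (cl (K0.of X))) where
  isSlicing := h.isSlicing
  add := (K0.of_add.comp cl).comp Z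
  ray φ X hX := by
    by_cases h0 : IsZero X
    · exact ⟨0, le_rfl, by
        rw [((K0.of_add.comp cl).comp Z).of_isZero h0, Complex.ofReal_zero, zero_mul]⟩
    · exact h.charge φ X hX h0

lemma mass_nonneg (X : C) : 0 ≤ mass cl P Z X := by
  unfold mass
  split_ifs
  · exact Finset.sum_nonneg fun _ _ ↦ norm_nonneg _
  · exact le_rfl

/-- `mass` is computed on a chosen filtration; `hn_unique` transfers the vanishing of charges from
any filtration to it. -/
lemma IsLaxCharge.massless_eq [IsTriangulated C] (h : IsLaxCharge P (fun X ↦ Z (cl (K0.of X)))) :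
    massless cl P Z = interval (masslessSlicing P (fun X ↦ Z (cl (K0.of X)))) Set.univ := by
  ext X
  have hne := h.isSlicing.exists_hn X
  have hmass : massless cl P Z X ↔ ∀ i < hne.some.n, Z (cl (K0.of (hne.some.factor i))) = 0 := by
    unfold massless mass
    rw [dif_pos hne, Finset.sum_eq_zero_iff_of_nonneg fun _ _ ↦ norm_nonneg _]
    simp
  rw [hmass]
  constructor
  · exact fun hX ↦ ⟨{ hne.some with
      semistable := fun i hi ↦ ⟨hne.some.semistable i hi, hX i hi⟩ }, fun _ _ ↦ trivial⟩
  · intro hX i hi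
    have := h.isClosedUnderIsomorphisms
    exact (h.isSlicing.hn_unique (R := masslessSlicing P _)
      (fun _ _ hY ↦ And.left hY) hX hne.some i hi).2.2

lemma K0.of_biprod (X Y : C) : K0.of (X ⊞ Y) = K0.of X + K0.of Y :=
  K0.of_add.add (binaryBiproductTriangle_distinguished X Y)

/-- Shifts realise negatives and biproducts realise sums, so every class is the class of one object.
-/
lemma K0.of_surjective : Function.Surjective (K0.of (C := C)) := by
  intro x
  obtain ⟨x, rfl⟩ := QuotientAddGroup.mk_surjective x
  induction x using FreeAbelianGroup.induction_on with
  | zero => exact ⟨0, K0.of_add.zero⟩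
  | of X => exact ⟨X, rfl⟩
  | neg X _ => exact ⟨X⟦(1 : ℤ)⟧, K0.of_add.shift_one X⟩
  | add x y hx hy =>
    obtain ⟨X, hX⟩ := hx
    obtain ⟨Y, hY⟩ := hy
    exact ⟨X ⊞ Y, by rw [K0.of_biprod, hX, hY, QuotientAddGroup.mk_add]⟩

lemma norm_ray {m φ : ℝ} (hm : 0 ≤ m) :
    ‖(m : ℂ) * Complex.exp (Complex.I * Real.pi * φ)‖ = m := by
  have : Complex.I * Real.pi * φ = ((Real.pi * φ : ℝ) : ℂ) * Complex.I := by
    push_cast; ring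
  rw [this, norm_mul, Complex.norm_exp_ofReal_mul_I, Complex.norm_real, mul_one,
    Real.norm_of_nonneg hm]

lemma norm_ray_add {m n φ : ℝ} (hm : 0 ≤ m) (hn : 0 ≤ n) :
    ‖(m : ℂ) * Complex.exp (Complex.I * Real.pi * φ) +
      (n : ℂ) * Complex.exp (Complex.I * Real.pi * φ)‖ = m + n := by
  rw [← add_mul, ← Complex.ofReal_add, norm_ray (add_nonneg hm hn)]

/-- The support property for massive stable objects implies the support property for all
semistable objects, with respect to the quotient norm. -/
lemma IsLaxStabilityCondition.quotient_support [IsTriangulated C]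
    {ip : InnerProductSpace.Core ℝ (ℝ ⊗[ℤ] Λ)}
    (h : IsLaxStabilityCondition (latticeNorm ip) cl P Z) {M : AddSubgroup Λ}
    (hM : ∀ X, massless cl P Z X → cl (K0.of X) ∈ M) :
    ∃ K : ℝ, 0 < K ∧ ∀ (φ : ℝ) (X : C), P φ X →
      1 / K * quotientNorm ip M (QuotientAddGroup.mk (cl (K0.of X))) ≤ ‖Z (cl (K0.of X))‖ := by
  obtain ⟨K, hK, hs⟩ := h.support
  have hc := h.isLaxCharge
  have hk := K0.of_add.comp cl
  have hzero : ∀ X : C, cl (K0.of X) ∈ M →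
      1 / K * quotientNorm ip M (QuotientAddGroup.mk (cl (K0.of X))) ≤ ‖Z (cl (K0.of X))‖ := by
    intro X hX
    rw [(QuotientAddGroup.eq_zero_iff _).2 hX]
    exact (mul_nonpos_of_nonneg_of_nonpos (by positivity) (quotientNorm_zero ip M)).trans
      (norm_nonneg _)
  refine ⟨K, hK, fun φ X hX ↦ h.isSlicing.induction_of_stable h.isLocallyFinite
    (q := fun X ↦ 1 / K * quotientNorm ip M (QuotientAddGroup.mk (cl (K0.of X))) ≤
      ‖Z (cl (K0.of X))‖) ?_ ?_ ?_ hX⟩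
  · exact fun X hX ↦ hzero X ((hk.of_isZero hX).symm ▸ zero_mem M)
  · intro X hX
    rcases (mass_nonneg (cl := cl) (P := P) (Z := Z) X).eq_or_lt with h0 | h0
    · exact hzero X (hM X h0.symm)
    · refine le_trans ?_ (hs φ X hX h0)
      exact mul_le_mul_of_nonneg_left (quotientNorm_mk_le ip M _) (by positivity)
  · intro T hT h₁ h₃ ih₁ ih₃
    obtain ⟨m, hm, e₁⟩ := hc.ray φ _ h₁
    obtain ⟨n, hn, e₃⟩ := hc.ray φ _ h₃
    rw [e₁, norm_ray hm] at ih₁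
    rw [e₃, norm_ray hn] at ih₃
    -- Both charges lie on the ray of phase `φ`, so their absolute values add, while the quotient
    -- norm is subadditive.
    rw [show cl (K0.of T.obj₂) = _ from hk T hT, map_add, e₁, e₃, norm_ray_add hm hn, QuotientAddGroup.mk_add]
    calc _ ≤ 1 / K * (quotientNorm ip M (QuotientAddGroup.mk (cl (K0.of T.obj₁))) +
          quotientNorm ip M (QuotientAddGroup.mk (cl (K0.of T.obj₃)))) := by
            exact mul_le_mul_of_nonneg_left (quotientNorm_add_le ip M _ _) (by positivity)
      _ ≤ m + n := by
        rw [mul_add]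
        exact add_le_add ih₁ ih₃

end Charge

end LaxStability

/-! ### Assembly of the theorem -/

open LaxStability

theorem mainTheorem2 {C : Type u} [Category.{v} C] [Preadditive C] [HasZeroObject C]
    [HasShift C ℤ] [∀ n : ℤ, (shiftFunctor C n).Additive] [Pretriangulated C] [IsTriangulated C]
    {Λ : Type w} [AddCommGroup Λ] [Module.Free ℤ Λ] [Module.Finite ℤ Λ]
    (ip : InnerProductSpace.Core ℝ (ℝ ⊗[ℤ] Λ))
    (cl : LaxStability.K0 C →+ Λ) (hcl : Function.Surjective cl)
    (P : ℝ → ObjectProperty C) (Z : Λ →+ ℂ)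
    (hσ : LaxStability.IsLaxPreStabilityCondition cl P Z)
    (N : ObjectProperty C) (hN : N = LaxStability.massless cl P Z)
    (ΛN : AddSubgroup Λ) (hΛN : ΛN = LaxStability.saturatedSublattice cl N) :
    -- `N` is thick, so that `C/N` is a triangulated category, and `Λ/Λ_N` is a lattice
    ∃ _ : N.IsTriangulated, N.IsStableUnderRetracts ∧
      Module.Free ℤ (Λ ⧸ ΛN) ∧ Module.Finite ℤ (Λ ⧸ ΛN) ∧
      -- the homomorphism `K(C/N) → Λ/Λ_N` induced by `cl` and the charge on `Λ/Λ_N` induced by `Z`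
      ∃ (cl' : LaxStability.K0 (LaxStability.VerdierQuotient N) →+ Λ ⧸ ΛN) (Z' : Λ ⧸ ΛN →+ ℂ),
        (∀ X : C, cl' (LaxStability.K0.of (N.trW.Q.obj X)) =
          QuotientAddGroup.mk (cl (LaxStability.K0.of X))) ∧
        Function.Surjective cl' ∧
        (∀ l : Λ, Z' (QuotientAddGroup.mk l) = Z l) ∧
        (LaxStability.IsWellAdapted N P →
          LaxStability.IsPreStabilityCondition cl' (LaxStability.quotientSlicing N P) Z') ∧
        (LaxStability.IsLaxStabilityCondition (LaxStability.latticeNorm ip) cl P Z →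
          LaxStability.IsStabilityCondition (LaxStability.quotientNorm ip ΛN) cl'
            (LaxStability.quotientSlicing N P) Z') := by

  have hc := hσ.isLaxCharge
  have hN' := hN.trans hc.massless_eq
  have hk := K0.of_add.comp cl
  have hNt : N.IsTriangulated := hN' ▸ hc.massless_isTriangulated
  have hNr : N.IsStableUnderRetracts := ⟨fun r hY ↦ by
    rw [hN'] at hY ⊢
    exact hc.massless_of_retract r hY⟩
  have hΛ : ∀ X, N X → cl (K0.of X) ∈ ΛN := fun X hX ↦ hΛN ▸ mem_saturatedSublattice cl N hX
  have hfree : Module.Free ℤ (Λ ⧸ ΛN) := hΛN ▸ free_quotient_saturatedSublattice cl N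
  have hfin : Module.Finite ℤ (Λ ⧸ ΛN) := Module.Finite.of_surjective
    (QuotientAddGroup.mk' ΛN).toIntLinearMap (QuotientAddGroup.mk'_surjective ΛN)
  -- The kernel of `Z` is primitive because `ℂ` is torsion-free, so it contains the saturation of
  -- the massless classes.
  have hker : ΛN ≤ Z.ker := hΛN ▸ saturatedSublattice_le cl N
    (fun X hX ↦ hc.charge_eq_zero (hN' ▸ hX)) fun k l hk hl ↦ by
      rw [AddMonoidHom.mem_ker, map_zsmul] at hl
      exact (smul_eq_zero.1 hl).resolve_left hk
  obtain ⟨cl', hcl'⟩ := exists_K0_lift (N := N) (hk.comp (QuotientAddGroup.mk' ΛN))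
    fun X hX ↦ (QuotientAddGroup.eq_zero_iff _).2 (hΛ X hX)
  let Z' : Λ ⧸ ΛN →+ ℂ := QuotientAddGroup.lift ΛN Z hker
  have hcl'' : ∀ {X : C} {Y : VerdierQuotient N}, (N.trW.Q.obj X ≅ Y) →
      cl' (K0.of Y) = QuotientAddGroup.mk (cl (K0.of X)) := fun e ↦ by
    rw [← K0.of_add.eq_of_iso e]
    exact hcl' _
  have hsl := hc.isSlicing_quotientSlicing hN'
  have charge : ∀ (φ : ℝ) (Y : VerdierQuotient N), quotientSlicing N P φ Y → ¬ IsZero Y →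
      ∃ m : ℝ, 0 < m ∧ Z' (cl' (K0.of Y)) = m * Complex.exp (Complex.I * Real.pi * φ) := by
    rintro φ Y ⟨X, hX, ⟨e⟩⟩ hY
    obtain ⟨m, hm, hZ⟩ := hc.ray φ X hX
    -- If `m = 0`, the semistable lift `X` is massless and `Y` is zero in the quotient.
    refine ⟨m, hm.lt_of_ne' fun h0 ↦ hY (IsZero.of_iso (isZero_Q_obj ?_) e.symm), ?_⟩
    · rw [hN']
      exact interval_of_mem (Set.mem_univ φ) ⟨hX, hZ.trans (by rw [h0, Complex.ofReal_zero, zero_mul])⟩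
    · rw [hcl'' e]
      exact hZ
  refine ⟨hNt, hNr, hfree, hfin, cl', Z', hcl', ?_, fun _ ↦ rfl, ?_, ?_⟩
  · intro q
    obtain ⟨l, rfl⟩ := QuotientAddGroup.mk_surjective q
    obtain ⟨κ, rfl⟩ := hcl l
    obtain ⟨X, rfl⟩ := K0.of_surjective κ
    exact ⟨_, hcl' X⟩
  · exact fun h ↦ ⟨hsl, h.isLocallyFinite_quotient, charge⟩
  · intro h
    obtain ⟨K, hK, hs⟩ := h.quotient_support (fun X hX ↦ hΛ X (hN ▸ hX))
    have support : ∀ (φ : ℝ) (Y : VerdierQuotient N), quotientSlicing N P φ Y →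
        1 / K * quotientNorm ip ΛN (cl' (K0.of Y)) ≤ ‖Z' (cl' (K0.of Y))‖ := by
      rintro φ Y ⟨X, hX, ⟨e⟩⟩
      rw [hcl'' e]
      exact hs φ X hX
    exact ⟨⟨hsl, hsl.isLocallyFinite_of_support (K0.of_add.comp cl') Z' charge
      (quotientNorm_zero ip ΛN) (quotientNorm_add_le ip ΛN) (finite_quotientNorm_le ip ΛN) hK
      support, charge⟩, K, hK, support⟩
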